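/- Theorem 1.1. Let $d,n\ge 1$ be integers, let $0<p_1,\dots,p_n\le\infty$ and $0<p<\infty$ with $1/p=1/p_1+\cdots+1/p_n$ (where $1/\infty=0$), and let $s_1,\dots,s_n>0$. Write $\widehat f(\xi)=\int f(x)e^{-2\pi i\langle x,\xi\rangle}\,dx$. For a bounded measurable function $\sigma$ on $(\mathbb{R}^d)^n$ and Schwartz functions $f_1,\dots,f_n$ on $\mathbb{R}^d$ put $$T_\sigma(f_1,\dots,f_n)(x)=\int_{(\mathbb{R}^d)^n}\sigma(\xi_1,\dots,\xi_n)\Big(\prod_{j=1}^n\widehat{f_j}(\xi_j)\Big)e^{2\pi i\langle x,\xi_1+\cdots+\xi_n\rangle}\,d\xi_1\cdots d\xi_n .$$ Let $\phi^{(n)}$ be any Schwartz function on $(\mathbb{R}^d)^n$ such that $\widehat{\phi^{(n)}}$ is supported in $\{\xi: 1/2\le|\xi|\le 2\}$ and $\sum_{k\in\mathbb{Z}}\widehat{\phi^{(n)}}(\xi/2^k)=1$ for all $\xi\ne 0$, and put $$\mathcal{L}[\sigma]=\sup_{k\in\mathbb{Z}}\big\|\sigma(2^k\,\cdot)\,\widehat{\phi^{(n)}}\big\|_{L^2_{(s_1,\dots,s_n)}},\qquad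 \|g\|_{L^2_{(s_1,\dots,s_n)}}=\Big(\int_{(\mathbb{R}^d)^n}\Big(\prod_{j=1}^n(1+4\pi^2|x_j|^2)^{s_j}\Big)|\widehat g(x_1,\dots,x_n)|^2\,dx_1\cdots dx_n\Big)^{1/2}.$$ Let $\|f\|_{H^r}=\big\|\sup_{t>0}|\Phi_t*f|\big\|_{L^r}$ for $0<r\le\infty$, where $\Phi$ is any fixed Schwartz function on $\mathbb{R}^d$ with $\int\Phi\neq 0$ and $\Phi_t(x)=t^{-d}\Phi(x/t)$. Let $\|T_\sigma\|_{H^{p_1}\times\cdots\times H^{p_n}\to L^p}\in[0,\infty]$ be the least constant $A$ such that $\|T_\sigma(f_1,\dots,f_n)\|_{L^p}\le A\prod_{j=1}^n\|f_j\|_{H^{p_j}}$ for all Schwartz functions $f_j$ with $\|f_j\|_{H^{p_j}}<\infty$ $(1\le j\le n)$. Suppose that $\min(s_1,\dots,s_n)\le d/2$, or that $$\sum_{k\in J}\Big(\frac{s_k}{d}-\frac1{p_k}\Big)\le-\frac12\qquad\text{for some nonempty }J\subset\{1,\dots,n\}.$$ Then there is no finite constant $C$ such that $$\|T_\sigma\|_{H^{p_1}\times\cdots\times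 H^{p_n}\to L^p}\le C\,\mathcal{L}[\sigma]$$ for all bounded measurable $\sigma$ with $\mathcal{L}[\sigma]<\infty$. -/

import Mathlib

open MeasureTheory
open scoped FourierTransform SchwartzMap ENNReal NNReal

noncomputable section

/-- The Euclidean space `ℝᵈ`. -/
abbrev Rd (d : ℕ) : Type := EuclideanSpace ℝ (Fin d)

/-- The space `(ℝᵈ)ⁿ` with the Euclidean norm `|ξ| = (|ξ₁|² + ⋯ + |ξₙ|²)^{1/2}` and with
Lebesgue measure; the `j`-th component of `ξ` is `ξ j`. -/
abbrev RdPow (d n : ℕ) : Type := PiLp 2 (fun _ : Fin n => Rd d)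

/-- The `n`-linear multiplier operator
`T_σ(f₁, …, fₙ)(x) = ∫ σ(ξ) (∏ⱼ f̂ⱼ(ξⱼ)) e^{2πi⟨x, ξ₁ + ⋯ + ξₙ⟩} dξ`, for Schwartz functions `fⱼ`,
where `f̂(ξ) = ∫ f(x) e^{-2πi⟨x, ξ⟩} dx`. -/
def multiplierOp {d n : ℕ} (σ : RdPow d n → ℂ) (f : Fin n → 𝓢(Rd d, ℂ)) (x : Rd d) : ℂ :=
  ∫ ξ : RdPow d n, σ ξ * (∏ j, 𝓕 (f j : Rd d → ℂ) (ξ j)) *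
    Complex.exp (2 * Real.pi * Complex.I * (inner ℝ x (∑ j, ξ j) : ℝ))

/-- The product-type Sobolev norm
`‖g‖ = (∫ (∏ⱼ (1 + 4π²|xⱼ|²)^{sⱼ}) |ĝ(x)|² dx)^{1/2} ∈ [0, ∞]` of an integrable function `g` on
`(ℝᵈ)ⁿ`. (It is used only for bounded functions with compact support.) -/
def productSobolevNorm {d n : ℕ} (s : Fin n → ℝ) (g : RdPow d n → ℂ) : ℝ≥0∞ :=
  (∫⁻ x : RdPow d n, ENNReal.ofReal
    ((∏ j, (1 + 4 * Real.pi ^ 2 * ‖x j‖ ^ 2) ^ (s j)) * ‖𝓕 g x‖ ^ 2)) ^ (1 / 2 : ℝ)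

/-- `φ` is a Schwartz function on `(ℝᵈ)ⁿ` whose Fourier transform is supported in the annulus
`1/2 ≤ |ξ| ≤ 2` and generates a dyadic partition of unity: `∑ₖ φ̂(ξ / 2ᵏ) = 1` for `ξ ≠ 0`. -/
structure IsDyadicPartition {d n : ℕ} (φ : 𝓢(RdPow d n, ℂ)) : Prop where
  supp : tsupport (𝓕 (φ : RdPow d n → ℂ)) ⊆ {ξ | 1 / 2 ≤ ‖ξ‖ ∧ ‖ξ‖ ≤ 2}
  sum_eq_one : ∀ ξ : RdPow d n, ξ ≠ 0 →
    HasSum (fun k : ℤ => 𝓕 (φ : RdPow d n → ℂ) (((2 : ℝ) ^ k)⁻¹ • ξ)) 1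

/-- `sup_{k ∈ ℤ} ‖σ(2ᵏ ·) φ̂‖`, the norm being the product-type Sobolev norm of order `s`. -/
def hormanderNorm {d n : ℕ} (φ : 𝓢(RdPow d n, ℂ)) (s : Fin n → ℝ) (σ : RdPow d n → ℂ) : ℝ≥0∞ :=
  ⨆ k : ℤ, productSobolevNorm s
    (fun ξ => σ ((2 : ℝ) ^ k • ξ) * 𝓕 (φ : RdPow d n → ℂ) ξ)

/-- The Hardy space quasi-norm `‖f‖_{H^p} = ‖sup_{t > 0} |Φ_t * f|‖_{L^p}`, `0 < p ≤ ∞`, with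
`Φ_t(x) = t⁻ᵈ Φ(x / t)`. Any two Schwartz functions `Φ` with nonzero integral give equivalent
quasi-norms. -/
def hardyNorm {d : ℕ} (Φ : 𝓢(Rd d, ℂ)) (p : ℝ≥0∞) (f : 𝓢(Rd d, ℂ)) : ℝ≥0∞ :=
  eLpNorm (fun x : Rd d => ⨆ t : ℝ, ⨆ _ : 0 < t,
    ‖∫ y : Rd d, (((t ^ d)⁻¹ : ℝ) : ℂ) * Φ (t⁻¹ • (x - y)) * f y‖ₑ) p volume

/-- The operator quasi-norm `‖T_σ‖_{H^{p₁} × ⋯ × H^{pₙ} → L^q} ∈ [0, ∞]`: the least `C` such that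
`‖T_σ(f₁, …, fₙ)‖_{L^q} ≤ C ∏ⱼ ‖fⱼ‖_{H^{pⱼ}}` for all Schwartz functions `fⱼ ∈ H^{pⱼ}`. -/
def multiplierOpNorm {d n : ℕ} (Φ : 𝓢(Rd d, ℂ)) (p : Fin n → ℝ≥0∞) (q : ℝ≥0∞)
    (σ : RdPow d n → ℂ) : ℝ≥0∞ :=
  sInf {C : ℝ≥0∞ | ∀ f : Fin n → 𝓢(Rd d, ℂ), (∀ j, hardyNorm Φ (p j) (f j) < ∞) →
    eLpNorm (multiplierOp σ f) q volume ≤ C * ∏ j, hardyNorm Φ (p j) (f j)}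

end

/-! The estimate is refuted by a family of multipliers depending on a radius `R → ∞`, for which all
integrals are free of cancellation. Fix a unit vector `e`, a nonempty `J` and `α ≥ 0`, and let `h(t)
= e^{2πi⟨t, |J|e⟩} (1 + |t|)^{-α}` on `|t| ≤ R`, zero elsewhere. Take `σ(ξ) = ĥ(∑_{k ∈ J} ξₖ) X(ξ)`,
where `X` is a smooth cutoff, supported away from `0`, equal to `1` where every `ξₖ` is within `1/4`
of `e`. Write `L = logMass d R`, which tends to infinity like `log R`.

Size of the multiplier. Only finitely many dyadic scales meet the support of `X`. At each one, the
Fourier transform of the localized multiplier is a superposition, with density `h`, of translates of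
a fixed Schwartz function along the diagonal of the coordinates in `J`. Hence its norm is at most a
constant times the `L²` norm of `h` with weight `(1 + |t|)^{2∑_J sⱼ}`
(`exists_hormanderNorm_diagMultiplier_le`), which is at most `L^{1/2}` if `2∑_J sⱼ - 2α ≤ -d`.

Size of the output. The test functions are `e^{2πi⟨x, e⟩}` times nonnegative functions, with
frequencies within `1/4` of `e`. All phases align, and `|T_σ f(x)|` is the integral of `|h(t)| ∏
|fₖ|`, with `fₖ` evaluated at `x - t` for `k ∈ J` and at `x` otherwise
(`enorm_multiplierOp_modulated`). As the frequencies stay away from `0`, the maximal functions have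
no worse tails than the functions themselves (`exists_maximal_le`), so Hardy norms are bounded by
`Lᵖ` norms of explicit weights, even for `p ≤ 1`.

If `sⱼ ≤ d/2`, take `J = {j}`, `α = d` and all `fₖ` plateaus of radius `R`. The output is at least a
multiple of `L` on a ball of radius `R/4`, the powers of `R` cancel because `1/q = ∑ 1/pₖ`, and the
estimate would give `L ≲ L^{1/2}`.

If `∑_J (sₖ/d - 1/pₖ) ≤ -1/2`, put `P = ∑_J 1/pₖ` and `α = dP`. For `k ∈ J` let `fₖ` be a fixed
bump, and for `k ∉ J` let `|fₖ|` be of size `(1 + |x|)^{-d/pₖ}` up to radius `R`. The output is at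
least a multiple of `(1 + |x|)^{-d/q}` for `|x| ≤ R/2`, so the estimate would give `L^{1/q} ≲ L^{1/2
+ ∑_{k ∉ J} 1/pₖ}`, that is `L^P ≲ L^{1/2}`. But `P > 1/2`, since the `sₖ` are positive. -/

/-! ### Product measure on `(ℝᵈ)ⁿ` and Fubini for oscillatory integrals -/

theorem measurePreserving_sigmaUncurry (ι κ : Type*) [Fintype ι] [Fintype κ] :
    MeasurePreserving (fun (f : ι → κ → ℝ) (x : Σ _ : ι, κ) => f x.1 x.2) := by
  have hm : Measurable (fun (f : ι → κ → ℝ) (x : Σ _ : ι, κ) => f x.1 x.2) := by fun_prop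
  refine ⟨hm, ?_⟩
  symm
  refine Measure.pi_eq fun s hs => ?_
  rw [Measure.map_apply hm (MeasurableSet.univ_pi hs)]
  have : (fun (f : ι → κ → ℝ) (x : Σ _ : ι, κ) => f x.1 x.2) ⁻¹' Set.univ.pi s =
      Set.univ.pi fun i => Set.univ.pi fun k => s ⟨i, k⟩ := by
    ext f
    simp [Set.mem_pi, Sigma.forall]
  rw [this, volume_pi_pi]
  simp_rw [volume_pi_pi]
  rw [← Finset.univ_sigma_univ, Finset.prod_sigma]

theorem measurePreserving_toLp_RdPow (d n : ℕ) :
    MeasurePreserving (fun f : Fin n → Rd d => (WithLp.toLp 2 f : RdPow d n)) := by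
  have h1 : MeasurePreserving
      (fun (f : Fin n → Rd d) (i : Fin n) => (WithLp.ofLp (f i) : Fin d → ℝ)) :=
    volume_preserving_pi fun _ => PiLp.volume_preserving_ofLp (Fin d)
  have h2 := (measurePreserving_sigmaUncurry (Fin n) (Fin d)).comp h1
  have h3 := (PiLp.volume_preserving_toLp (Σ _ : Fin n, Fin d)).comp h2
  exact (LinearIsometryEquiv.piLpCurry ℝ 2
    (fun (_ : Fin n) (_ : Fin d) => ℝ)).measurePreserving.comp h3

theorem measurableEmbedding_toLp_RdPow (d n : ℕ) :
    MeasurableEmbedding (fun f : Fin n → Rd d => (WithLp.toLp 2 f : RdPow d n)) :=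
  (MeasurableEquiv.toLp 2 (Fin n → Rd d)).measurableEmbedding

theorem integral_prod_RdPow {d n : ℕ} (f : Fin n → Rd d → ℂ) :
    ∫ ξ : RdPow d n, ∏ k, f k (ξ k) = ∏ k, ∫ x, f k x := by
  rw [← integral_fintype_prod_volume_eq_prod,
    ← (measurePreserving_toLp_RdPow d n).integral_comp (measurableEmbedding_toLp_RdPow d n)]

theorem integrable_prod_RdPow {d n : ℕ} {f : Fin n → Rd d → ℂ} (hf : ∀ k, Integrable (f k)) :
    Integrable fun ξ : RdPow d n => ∏ k, f k (ξ k) := by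
  rw [← (measurePreserving_toLp_RdPow d n).integrable_comp_emb (measurableEmbedding_toLp_RdPow d n)]
  exact Integrable.fintype_prod hf

section Fubini

variable {V W : Type*} [NormedAddCommGroup V] [MeasureSpace V] [BorelSpace V]
  [SecondCountableTopology V] [SFinite (volume : Measure V)]
  [NormedAddCommGroup W] [MeasureSpace W] [BorelSpace W]
  [SFinite (volume : Measure W)]

/-- The character is unimodular, so `|g| ⊗ |h|` dominates and Fubini applies. This one exchange
underlies the convolution formula, the kernel formula for the operator, and the Fourier transform of
the localized multiplier. -/
theorem integral_fourierChar_swap {h : V → ℂ} {g : W → ℂ} (hh : Integrable h) (hg : Integrable g)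
    {L : W → V → ℝ} (hL : Continuous fun z : W × V => L z.1 z.2) :
    ∫ ξ, (∫ t, 𝐞 (L ξ t) • h t) * g ξ = ∫ t, h t * ∫ ξ, 𝐞 (L ξ t) • g ξ := by
  have hint : Integrable (fun z : W × V => 𝐞 (L z.1 z.2) • (g z.1 * h z.2)) := by
    have h0 : Integrable (fun z : W × V => g z.1 * h z.2) := hg.mul_prod hh
    have h1 : AEStronglyMeasurable (fun z : W × V => ((𝐞 (L z.1 z.2) : Circle) : ℂ)) :=
      (continuous_subtype_val.comp (Real.continuous_fourierChar.comp hL)).aestronglyMeasurable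
    refine h0.mono (h1.mul h0.1) (Filter.Eventually.of_forall fun z => ?_)
    simp [Circle.norm_smul]
  calc ∫ ξ, (∫ t, 𝐞 (L ξ t) • h t) * g ξ
      = ∫ ξ, ∫ t, 𝐞 (L ξ t) • (g ξ * h t) := by
        congr 1; ext ξ
        rw [← integral_mul_const]
        congr 1; ext t
        simp only [Circle.smul_def, smul_eq_mul]; ring
    _ = ∫ t, ∫ ξ, 𝐞 (L ξ t) • (g ξ * h t) := integral_integral_swap hint
    _ = _ := by
        congr 1; ext t
        rw [← integral_const_mul]
        congr 1; ext ξ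
        simp only [Circle.smul_def, smul_eq_mul]; ring

end Fubini

theorem fourierInv_fourier_mul {V : Type*} [NormedAddCommGroup V] [InnerProductSpace ℝ V]
    [FiniteDimensional ℝ V] [MeasurableSpace V] [BorelSpace V] {G g : V → ℂ}
    (hG : Integrable G) (hg : Integrable g) (x : V) :
    𝓕⁻ (fun ξ => 𝓕 G ξ * g ξ) x = ∫ y, G y * 𝓕⁻ g (x - y) := by
  have hg' : Integrable fun ξ => 𝐞 (inner ℝ ξ x) • g ξ := by
    have : AEStronglyMeasurable (fun ξ : V => ((𝐞 (inner ℝ ξ x) : Circle) : ℂ)) :=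
      (continuous_subtype_val.comp (Real.continuous_fourierChar.comp
        (by fun_prop))).aestronglyMeasurable
    refine hg.mono (this.mul hg.1) (Filter.Eventually.of_forall fun z => ?_)
    simp [Circle.norm_smul]
  have := integral_fourierChar_swap (L := fun ξ y => -(inner ℝ y ξ : ℝ)) hG hg' (by fun_prop)
  simp only [Real.fourierInv_eq]
  simp only [Real.fourier_eq]
  refine Eq.trans ?_ (this.trans ?_)
  · congr 1; ext ξ
    simp only [Circle.smul_def, smul_eq_mul]; ring
  · congr 1; ext y
    congr 2; ext ξ
    rw [smul_smul, ← AddChar.map_add_eq_mul]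
    congr 2
    rw [inner_sub_right, real_inner_comm]; ring

/-! ### Multipliers that depend on `∑_{k ∈ J} ξₖ` -/

/-- The embedding of `ℝᵈ` into `(ℝᵈ)ⁿ` as the diagonal of the coordinates in `J`. -/
noncomputable def diagEmbedding {d n : ℕ} (J : Finset (Fin n)) (t : Rd d) : RdPow d n :=
  WithLp.toLp 2 fun k => if k ∈ J then t else 0

theorem diagEmbedding_apply {d n : ℕ} (J : Finset (Fin n)) (t : Rd d) (k : Fin n) :
    diagEmbedding J t k = if k ∈ J then t else 0 := rfl

theorem continuous_diagEmbedding {d n : ℕ} (J : Finset (Fin n)) :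
    Continuous (diagEmbedding J : Rd d → RdPow d n) := by
  refine (PiLp.continuous_toLp 2 _).comp (continuous_pi fun k => ?_)
  split_ifs <;> fun_prop

/-- The multiplier `ξ ↦ ĥ(∑_{k ∈ J} ξₖ)`. -/
noncomputable def diagMultiplier {d n : ℕ} (J : Finset (Fin n)) (h : Rd d → ℂ)
    (ξ : RdPow d n) : ℂ :=
  ∫ t, 𝐞 (-(inner ℝ (diagEmbedding J t) ξ)) • h t

theorem diagMultiplier_eq {d n : ℕ} (J : Finset (Fin n)) (h : Rd d → ℂ) (ξ : RdPow d n) :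
    diagMultiplier J h ξ = 𝓕 h (∑ k ∈ J, ξ k) := by
  rw [Real.fourier_eq, diagMultiplier]
  congr! 6 with t
  simp [PiLp.inner_apply, diagEmbedding_apply, inner_sum, Finset.sum_ite_mem, apply_ite, ite_apply]

theorem norm_diagMultiplier_le {d n : ℕ} (J : Finset (Fin n)) (h : Rd d → ℂ) (ξ : RdPow d n) :
    ‖diagMultiplier J h ξ‖ ≤ ∫ t, ‖h t‖ := by
  refine (norm_integral_le_integral_norm _).trans_eq ?_
  simp [Circle.norm_smul]

theorem continuous_diagMultiplier {d n : ℕ} (J : Finset (Fin n)) {h : Rd d → ℂ}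
    (hh : Integrable h) : Continuous (diagMultiplier J h : RdPow d n → ℂ) := by
  have : (diagMultiplier J h : RdPow d n → ℂ) = 𝓕 h ∘ fun ξ => ∑ k ∈ J, ξ k :=
    funext fun ξ => diagMultiplier_eq J h ξ
  rw [this]
  refine Continuous.comp ?_ (by fun_prop)
  exact VectorFourier.fourierIntegral_continuous Real.continuous_fourierChar
    (by exact continuous_inner) hh

/-- For fixed `t` the character `ξ ↦ e^{-2πi⟨t, ∑_J ξₖ⟩}` splits over the coordinates, so the inner
integral is a product of Fourier inversions, each translated by `t` or not. By `hX` the cutoff is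
invisible to the functions `fₖ`. -/
theorem multiplierOp_diagMultiplier {d n : ℕ} (J : Finset (Fin n)) {h : Rd d → ℂ}
    (hh : Integrable h) (X : RdPow d n → ℂ) (f : Fin n → 𝓢(Rd d, ℂ))
    (hX : ∀ ξ, X ξ * ∏ k, 𝓕 (f k : Rd d → ℂ) (ξ k) = ∏ k, 𝓕 (f k : Rd d → ℂ) (ξ k)) (x : Rd d) :
    multiplierOp (fun ξ => diagMultiplier J h ξ * X ξ) f x =
      ∫ t, h t * ∏ k, f k (x - if k ∈ J then t else 0) := by
  set g : RdPow d n → ℂ := fun ξ => ∏ k, (𝐞 (inner ℝ (ξ k) x) • 𝓕 (f k : Rd d → ℂ) (ξ k)) with hg_def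
  have hg : Integrable g := by
    refine integrable_prod_RdPow (f := fun k η => 𝐞 (inner ℝ η x) • 𝓕 (f k : Rd d → ℂ) η) fun k => ?_
    have h1 : AEStronglyMeasurable (fun ξ : Rd d => ((𝐞 (inner ℝ ξ x) : Circle) : ℂ)) :=
      (continuous_subtype_val.comp (Real.continuous_fourierChar.comp
        (by fun_prop))).aestronglyMeasurable
    have h2 : Integrable (𝓕 (f k : Rd d → ℂ)) := by
      rw [← SchwartzMap.fourier_coe]; exact (𝓕 (f k)).integrable
    refine h2.mono (h1.mul h2.1) (Filter.Eventually.of_forall fun z => ?_)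
    simp [Circle.norm_smul]
  have hsw := integral_fourierChar_swap
    (L := fun (ξ : RdPow d n) (t : Rd d) => -(inner ℝ (diagEmbedding J t) ξ : ℝ)) hh hg
    (by have := continuous_diagEmbedding (d := d) J; fun_prop)
  rw [multiplierOp]
  refine Eq.trans ?_ (hsw.trans ?_)
  · congr 1; ext ξ
    rw [diagMultiplier, mul_assoc _ (X ξ), hX, mul_assoc]
    congr 1
    simp only [hg_def, Circle.smul_def, smul_eq_mul, Finset.prod_mul_distrib]
    rw [mul_comm]
    congr 1
    simp only [Real.fourierChar_apply, ← Complex.exp_sum]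
    congr 1
    simp only [inner_sum, Complex.ofReal_sum, Finset.mul_sum, Complex.ofReal_mul]
    refine Finset.sum_congr rfl fun k _ => ?_
    rw [real_inner_comm]
    push_cast; ring
  · congr 1; ext t
    congr 1
    have key : ∀ k, f k (x - if k ∈ J then t else 0) =
        ∫ η : Rd d, 𝐞 (-(inner ℝ (if k ∈ J then t else 0) η : ℝ)) •
          (𝐞 (inner ℝ η x) • 𝓕 (f k : Rd d → ℂ) η) := by
      intro k
      have h3 : (f k : Rd d → ℂ) = 𝓕⁻ (𝓕 (f k : Rd d → ℂ)) := by
        rw [← SchwartzMap.fourier_coe, ← SchwartzMap.fourierInv_coe, FourierTransform.fourierInv_fourier_eq]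
      conv_lhs => rw [h3]
      rw [Real.fourierInv_eq]
      congr 1; ext η
      rw [smul_smul, ← AddChar.map_add_eq_mul]
      congr 2
      rw [inner_sub_right, real_inner_comm η (if k ∈ J then t else 0)]; ring
    simp_rw [key]
    rw [← integral_prod_RdPow fun k η => 𝐞 (-(inner ℝ (if k ∈ J then t else 0) η : ℝ)) •
          (𝐞 (inner ℝ η x) • 𝓕 (f k : Rd d → ℂ) η)]
    congr 1; ext ξ
    simp only [hg_def, Circle.smul_def, smul_eq_mul, Finset.prod_mul_distrib]
    congr 1
    simp only [Real.fourierChar_apply, ← Complex.exp_sum]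
    congr 1
    simp only [PiLp.inner_apply, diagEmbedding_apply, ← Finset.sum_neg_distrib, Complex.ofReal_sum,
      Finset.mul_sum, Finset.sum_mul]

/-! ### The Hörmander norm of the multiplier -/

theorem SchwartzMap.norm_le_one_add_norm_rpow {V : Type*} [NormedAddCommGroup V]
    [NormedSpace ℝ V] (f : 𝓢(V, ℂ)) {r : ℝ} {N : ℕ} (hN : r ≤ N) (x : V) :
    ‖f x‖ ≤ 2 ^ N * ((Finset.Iic (N, 0)).sup (schwartzSeminormFamily ℝ V ℂ)) f *
      (1 + ‖x‖) ^ (-r) := by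
  have h := SchwartzMap.one_add_le_sup_seminorm_apply (𝕜 := ℝ) (m := (N, 0)) le_rfl le_rfl f x
  rw [norm_iteratedFDeriv_zero] at h
  have h1 : (1 : ℝ) ≤ 1 + ‖x‖ := by linarith [norm_nonneg x]
  have h0 : 0 < 1 + ‖x‖ := by positivity
  rw [Real.rpow_neg h0.le, ← div_eq_mul_inv, le_div_iff₀ (by positivity), mul_comm]
  refine le_trans ?_ h
  gcongr
  rw [← Real.rpow_natCast]
  exact Real.rpow_le_rpow_of_exponent_le h1 hN

theorem SchwartzMap.exists_norm_le_one_add_norm_rpow {V : Type*} [NormedAddCommGroup V]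
    [NormedSpace ℝ V] (f : 𝓢(V, ℂ)) (r : ℝ) :
    ∃ C : ℝ, 0 ≤ C ∧ ∀ x, ‖f x‖ ≤ C * (1 + ‖x‖) ^ (-r) := by
  obtain ⟨N, hN⟩ := exists_nat_ge r
  exact ⟨_, by positivity, fun x => f.norm_le_one_add_norm_rpow hN x⟩

/-- The translation by `l • diagEmbedding J t` moves only the coordinates in `J`. This is why growth
in `t` costs only `∑_{j ∈ J} sⱼ` and not the full sum. -/
theorem prod_one_add_norm_sq_rpow_le {d n : ℕ} (J : Finset (Fin n)) {s : Fin n → ℝ}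
    (hs : ∀ j, 0 < s j) {l : ℝ} (hl : 0 ≤ l) (x : RdPow d n) (t : Rd d) :
    ∏ j, (1 + 4 * Real.pi ^ 2 * ‖x j‖ ^ 2) ^ (s j) ≤
      (2 * Real.pi * (1 + l)) ^ (2 * ∑ j, s j) * (1 + ‖x + l • diagEmbedding J t‖) ^ (2 * ∑ j, s j) *
        (1 + ‖t‖) ^ (2 * ∑ j ∈ J, s j) := by
  set y := x + l • diagEmbedding J t with hy
  have hpi := Real.pi_gt_three
  have h2 : ∀ k, (1 + 4 * Real.pi ^ 2 * ‖x k‖ ^ 2) ^ (s k) ≤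
      (2 * Real.pi * (1 + l)) ^ (2 * s k) * (1 + ‖y‖) ^ (2 * s k) *
        (if k ∈ J then (1 + ‖t‖) ^ (2 * s k) else 1) := by
    intro k
    have hyk : ‖y k‖ ≤ ‖y‖ := PiLp.norm_apply_le y k
    set E : ℝ := if k ∈ J then (1 + ‖t‖) else 1 with hE
    have hE1 : 1 ≤ E := by rw [hE]; split_ifs <;> linarith [norm_nonneg t]
    have hx : 1 + ‖x k‖ ≤ (1 + l) * (1 + ‖y‖) * E := by
      have hxy : x k = y k - l • (if k ∈ J then t else 0) := by
        simp [hy, diagEmbedding_apply]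
      rw [hxy]
      rw [hE]
      split_ifs
      · have h3 := norm_sub_le (y k) (l • t)
        rw [norm_smul, Real.norm_of_nonneg hl] at h3
        have : 0 ≤ ‖y‖ * ‖t‖ := by positivity
        have : 0 ≤ l * ‖y‖ * ‖t‖ := by positivity
        have : 0 ≤ l * ‖y‖ := by positivity
        have : 0 ≤ ‖t‖ := by positivity
        nlinarith
      · have : 0 ≤ l * ‖y‖ := by positivity
        simp only [smul_zero, sub_zero]
        nlinarith
    have hsq : 1 + 4 * Real.pi ^ 2 * ‖x k‖ ^ 2 ≤ ((2 * Real.pi * (1 + l)) * (1 + ‖y‖) * E) ^ (2 : ℝ) := by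
      rw [Real.rpow_two]
      calc 1 + 4 * Real.pi ^ 2 * ‖x k‖ ^ 2 ≤ (2 * Real.pi * (1 + ‖x k‖)) ^ 2 := by
            have := norm_nonneg (x k)
            nlinarith [mul_nonneg this (sq_nonneg Real.pi)]
        _ ≤ (2 * Real.pi * ((1 + l) * (1 + ‖y‖) * E)) ^ 2 := by gcongr
        _ = _ := by ring
    have hE2 : (if k ∈ J then (1 + ‖t‖) ^ (2 * s k) else 1) = E ^ (2 * s k) := by
      rw [hE]; split_ifs <;> simp
    rw [hE2, ← Real.mul_rpow (by positivity) (by positivity),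
      ← Real.mul_rpow (by positivity) (by positivity), Real.rpow_mul (by positivity)]
    exact Real.rpow_le_rpow (by positivity) hsq (hs k).le
  refine (Finset.prod_le_prod (fun k _ => by positivity) fun k _ => h2 k).trans_eq ?_
  rw [Finset.prod_mul_distrib, Finset.prod_mul_distrib, Finset.mul_sum, Finset.mul_sum,
    Real.rpow_sum_of_pos (by positivity), Real.rpow_sum_of_pos (by positivity),
    Real.rpow_sum_of_pos (by positivity), Finset.prod_ite_mem, Finset.univ_inter]

theorem fourier_diagMultiplier_mul {d n : ℕ} (J : Finset (Fin n)) {h : Rd d → ℂ}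
    (hh : Integrable h) (Ψ : 𝓢(RdPow d n, ℂ)) (l : ℝ) (x : RdPow d n) :
    𝓕 (fun ξ => diagMultiplier J h (l • ξ) * Ψ ξ) x =
      ∫ t, h t * 𝓕 (Ψ : RdPow d n → ℂ) (x + l • diagEmbedding J t) := by
  have hg : Integrable fun ξ => 𝐞 (-(inner ℝ ξ x)) • Ψ ξ := by
    have h1 : AEStronglyMeasurable (fun ξ : RdPow d n => ((𝐞 (-(inner ℝ ξ x)) : Circle) : ℂ)) :=
      (continuous_subtype_val.comp (Real.continuous_fourierChar.comp
        (by fun_prop))).aestronglyMeasurable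
    refine Ψ.integrable.mono (h1.mul Ψ.integrable.1) (Filter.Eventually.of_forall fun z => ?_)
    simp [Circle.norm_smul]
  have hsw := integral_fourierChar_swap
    (L := fun (ξ : RdPow d n) (t : Rd d) => -(inner ℝ (diagEmbedding J t) (l • ξ) : ℝ)) hh hg
    (by have := continuous_diagEmbedding (d := d) J; fun_prop)
  simp only [Real.fourier_eq]
  refine Eq.trans ?_ (hsw.trans ?_)
  · congr 1; ext ξ
    rw [diagMultiplier]
    simp only [Circle.smul_def, smul_eq_mul]; ring
  · congr 1; ext t
    congr 2; ext ξ
    rw [smul_smul, ← AddChar.map_add_eq_mul]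
    congr 2
    rw [inner_add_right, inner_smul_right, inner_smul_right, real_inner_comm ξ]; ring

theorem sq_lintegral_mul_mul_le {α : Type*} [MeasurableSpace α] {μ : Measure α} {f k : α → ℝ≥0∞}
    (hf : AEMeasurable f μ) (hk : AEMeasurable k μ) :
    (∫⁻ t, f t * k t ^ 2 ∂μ) ^ 2 ≤ (∫⁻ t, f t ^ 2 * k t ^ 2 ∂μ) * ∫⁻ t, k t ^ 2 ∂μ := by
  have h := ENNReal.lintegral_mul_le_Lp_mul_Lq μ Real.HolderConjugate.two_two (hf.mul hk) hk
  have e : ∀ a : ℝ≥0∞, (a ^ (1 / 2 : ℝ)) ^ 2 = a := fun a => by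
    rw [← ENNReal.rpow_natCast, ← ENNReal.rpow_mul]; norm_num
  calc (∫⁻ t, f t * k t ^ 2 ∂μ) ^ 2 = (∫⁻ t, ((f * k) * k) t ∂μ) ^ 2 := by
        congr 2; ext t; simp only [Pi.mul_apply]; ring
    _ ≤ ((∫⁻ t, (f * k) t ^ (2:ℝ) ∂μ) ^ (1 / 2 : ℝ) * (∫⁻ t, k t ^ (2:ℝ) ∂μ) ^ (1 / 2 : ℝ)) ^ 2 := by
        gcongr
    _ = _ := by
        rw [mul_pow, e, e]
        simp [mul_pow]

theorem lintegral_one_add_norm_rpow_lt_top {V : Type*} [NormedAddCommGroup V] [NormedSpace ℝ V]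
    [FiniteDimensional ℝ V] [MeasurableSpace V] [BorelSpace V] (μ : Measure V) [μ.IsAddHaarMeasure]
    {r : ℝ} (hr : (Module.finrank ℝ V : ℝ) < r) :
    ∫⁻ x, ENNReal.ofReal ((1 + ‖x‖) ^ (-r)) ∂μ < ∞ := by
  have := (integrable_one_add_norm (μ := μ) hr).2
  rwa [hasFiniteIntegral_iff_ofReal (Filter.Eventually.of_forall fun x => by positivity)] at this

theorem lintegral_comp_smul_Rd {d : ℕ} {f : Rd d → ℝ≥0∞} (hf : Measurable f) {l : ℝ} (hl : 0 < l) :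
    ∫⁻ x, f (l • x) = ENNReal.ofReal (l ^ (-(d : ℝ))) * ∫⁻ x, f x := by
  rw [← lintegral_map (μ := volume) hf (measurable_const_smul l),
    Measure.map_addHaar_smul _ hl.ne', lintegral_smul_measure]
  simp only [finrank_euclideanSpace, Fintype.card_fin]
  rw [abs_of_nonneg (by positivity), Real.rpow_neg hl.le, Real.rpow_natCast, smul_eq_mul]

/-- `Ψ̂` decays rapidly, so its translate is concentrated at `-l • diagEmbedding J t`, where the
product weight is of order at most `(1 + |t|)^{2∑_J sⱼ}`. Cauchy–Schwarz in `t` followed by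
integration in `x` turns this into a weighted `L²` bound, with `C` independent of `h`. -/
theorem exists_productSobolevNorm_diagMultiplier_le {d n : ℕ} {J : Finset (Fin n)}
    (hJ : J.Nonempty) {s : Fin n → ℝ} (hs : ∀ j, 0 < s j) (Ψ : 𝓢(RdPow d n, ℂ)) {l : ℝ}
    (hl : 0 < l) :
    ∃ C : ℝ≥0, ∀ h : Rd d → ℂ, Measurable h → Integrable h →
      productSobolevNorm s (fun ξ => diagMultiplier J h (l • ξ) * Ψ ξ) ≤
        C * (∫⁻ t, ENNReal.ofReal ((1 + ‖t‖) ^ (2 * ∑ j ∈ J, s j)) * ‖h t‖ₑ ^ 2) ^ (1 / 2 : ℝ) := by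
  obtain ⟨j₀, hj₀⟩ := hJ
  set S : ℝ := 2 * ∑ j, s j with hS
  have hS0 : 0 ≤ S := by
    have : 0 ≤ ∑ j, s j := Finset.sum_nonneg fun j _ => (hs j).le
    positivity
  set D : ℝ := (Module.finrank ℝ (RdPow d n) : ℝ) with hD
  -- The decay must absorb the weight, of order `S`, and remain integrable over the `D`-dimensional
  -- space in `x`; it must also be integrable over `ℝᵈ` in `t`.
  set r : ℝ := S + D + d + 1 with hr
  have hD0 : 0 ≤ D := by positivity
  have hr0 : 0 < r := by positivity
  obtain ⟨A, hA0, hA⟩ := (𝓕 Ψ).exists_norm_le_one_add_norm_rpow r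
  set κ : RdPow d n → ℝ≥0∞ := fun y => ENNReal.ofReal ((1 + ‖y‖) ^ (-r / 2)) with hκ
  have hκm : Measurable κ := by fun_prop
  have hκ2 : ∀ y, κ y ^ 2 = ENNReal.ofReal ((1 + ‖y‖) ^ (-r)) := fun y => by
    rw [hκ, ← ENNReal.ofReal_pow (by positivity), ← Real.rpow_natCast, ← Real.rpow_mul (by positivity)]
    congr 2; push_cast; ring
  have hΨ : ∀ y, ‖𝓕 (Ψ : RdPow d n → ℂ) y‖ₑ ≤ ENNReal.ofReal A * κ y ^ 2 := fun y => by
    rw [hκ2, ← ENNReal.ofReal_mul hA0, ← ofReal_norm]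
    exact ENNReal.ofReal_le_ofReal (hA y)
  have hdm := (continuous_diagEmbedding (d := d) J).measurable
  set B : ℝ≥0∞ := ENNReal.ofReal (l ^ (-(d : ℝ))) *
    ∫⁻ u : Rd d, ENNReal.ofReal ((1 + ‖u‖) ^ (-r)) with hB
  have hBtop : B < ∞ := by
    refine ENNReal.mul_lt_top ENNReal.ofReal_lt_top (lintegral_one_add_norm_rpow_lt_top _ ?_)
    simp only [finrank_euclideanSpace, Fintype.card_fin]; linarith
  -- A single coordinate `j₀ ∈ J` already gives decay in `t`, uniformly in `x`; this is where `J`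
  -- must be nonempty.
  have hB' : ∀ x : RdPow d n, ∫⁻ t, κ (x + l • diagEmbedding J t) ^ 2 ≤ B := by
    intro x
    calc ∫⁻ t, κ (x + l • diagEmbedding J t) ^ 2
        ≤ ∫⁻ t, ENNReal.ofReal ((1 + ‖x j₀ + l • t‖) ^ (-r)) := by
          refine lintegral_mono fun t => ?_
          rw [hκ2]
          refine ENNReal.ofReal_le_ofReal ?_
          have h1 : ‖x j₀ + l • t‖ ≤ ‖x + l • diagEmbedding J t‖ := by
            have := PiLp.norm_apply_le (x + l • diagEmbedding J t) j₀
            simpa [diagEmbedding_apply, hj₀] using this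
          exact Real.rpow_le_rpow_of_nonpos (by positivity) (by linarith) (by linarith)
      _ = B := by
          have h2 := lintegral_comp_smul_Rd
            (f := fun u : Rd d => ENNReal.ofReal ((1 + ‖x j₀ + u‖) ^ (-r))) (by fun_prop) hl
          refine h2.trans ?_
          rw [lintegral_add_left_eq_self (fun u : Rd d => ENNReal.ofReal ((1 + ‖u‖) ^ (-r))) (x j₀)]
  set Q : ℝ≥0∞ := ∫⁻ y : RdPow d n, ENNReal.ofReal ((1 + ‖y‖) ^ (S - r)) with hQ
  have hQtop : Q < ∞ := by
    have := lintegral_one_add_norm_rpow_lt_top (volume : Measure (RdPow d n)) (r := r - S)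
      (by rw [← hD]; have : (0:ℝ) ≤ d := by positivity
          linarith)
    rwa [neg_sub] at this
  set P : ℝ := (2 * Real.pi * (1 + l)) ^ S with hP
  have hP0 : 0 ≤ P := by positivity
  set K : ℝ≥0∞ := ENNReal.ofReal P * ENNReal.ofReal A ^ 2 * B * Q with hK
  have hKtop : K < ∞ := by
    refine ENNReal.mul_lt_top (ENNReal.mul_lt_top (ENNReal.mul_lt_top ENNReal.ofReal_lt_top ?_) hBtop) hQtop
    exact ENNReal.pow_lt_top ENNReal.ofReal_lt_top
  refine ⟨(K ^ (1 / 2 : ℝ)).toNNReal, fun h hm hint => ?_⟩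
  rw [ENNReal.coe_toNNReal (ENNReal.rpow_lt_top_of_nonneg (by norm_num) hKtop.ne).ne,
    ← ENNReal.mul_rpow_of_nonneg _ _ (by norm_num), productSobolevNorm]
  refine ENNReal.rpow_le_rpow ?_ (by norm_num)
  have hpt : ∀ x, ‖𝓕 (fun ξ => diagMultiplier J h (l • ξ) * Ψ ξ) x‖ₑ ^ 2 ≤
      ENNReal.ofReal A ^ 2 * B * ∫⁻ t, ‖h t‖ₑ ^ 2 * κ (x + l • diagEmbedding J t) ^ 2 := by
    intro x
    have h1 : ‖𝓕 (fun ξ => diagMultiplier J h (l • ξ) * Ψ ξ) x‖ₑ ≤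
        ENNReal.ofReal A * ∫⁻ t, ‖h t‖ₑ * κ (x + l • diagEmbedding J t) ^ 2 := by
      rw [fourier_diagMultiplier_mul J hint]
      refine (enorm_integral_le_lintegral_enorm _).trans ?_
      rw [← lintegral_const_mul _ (by fun_prop)]
      refine lintegral_mono fun t => ?_
      simp only [enorm_mul]
      calc _ ≤ ‖h t‖ₑ * (ENNReal.ofReal A * κ (x + l • diagEmbedding J t) ^ 2) := by gcongr; exact hΨ _
        _ = _ := by ring
    calc _ ≤ (ENNReal.ofReal A * ∫⁻ t, ‖h t‖ₑ * κ (x + l • diagEmbedding J t) ^ 2) ^ 2 := by gcongr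
      _ = ENNReal.ofReal A ^ 2 * (∫⁻ t, ‖h t‖ₑ * κ (x + l • diagEmbedding J t) ^ 2) ^ 2 := by ring
      _ ≤ ENNReal.ofReal A ^ 2 * ((∫⁻ t, ‖h t‖ₑ ^ 2 * κ (x + l • diagEmbedding J t) ^ 2) * B) := by
          gcongr
          refine (sq_lintegral_mul_mul_le (by fun_prop) (by fun_prop)).trans ?_
          gcongr
          exact hB' x
      _ = _ := by ring
  have hW : ∀ (x : RdPow d n) (t : Rd d),
      ENNReal.ofReal (∏ j, (1 + 4 * Real.pi ^ 2 * ‖x j‖ ^ 2) ^ (s j)) *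
        (‖h t‖ₑ ^ 2 * κ (x + l • diagEmbedding J t) ^ 2) ≤
      ENNReal.ofReal P * ((ENNReal.ofReal ((1 + ‖t‖) ^ (2 * ∑ j ∈ J, s j)) * ‖h t‖ₑ ^ 2) *
        ENNReal.ofReal ((1 + ‖x + l • diagEmbedding J t‖) ^ (S - r))) := by
    intro x t
    have h1 := ENNReal.ofReal_le_ofReal (prod_one_add_norm_sq_rpow_le J hs hl.le x t)
    rw [← hS, ← hP, ENNReal.ofReal_mul (by positivity), ENNReal.ofReal_mul hP0] at h1
    calc _ ≤ (ENNReal.ofReal P * ENNReal.ofReal ((1 + ‖x + l • diagEmbedding J t‖) ^ S) *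
          ENNReal.ofReal ((1 + ‖t‖) ^ (2 * ∑ j ∈ J, s j))) *
          (‖h t‖ₑ ^ 2 * κ (x + l • diagEmbedding J t) ^ 2) := by gcongr
      _ = ENNReal.ofReal P * ((ENNReal.ofReal ((1 + ‖t‖) ^ (2 * ∑ j ∈ J, s j)) * ‖h t‖ₑ ^ 2) *
          (ENNReal.ofReal ((1 + ‖x + l • diagEmbedding J t‖) ^ S) *
            ENNReal.ofReal ((1 + ‖x + l • diagEmbedding J t‖) ^ (-r)))) := by rw [hκ2]; ring
      _ = _ := by
          rw [← ENNReal.ofReal_mul (by positivity), ← Real.rpow_add (by positivity), sub_eq_add_neg]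
  calc ∫⁻ x : RdPow d n, ENNReal.ofReal ((∏ j, (1 + 4 * Real.pi ^ 2 * ‖x j‖ ^ 2) ^ (s j)) *
        ‖𝓕 (fun ξ => diagMultiplier J h (l • ξ) * Ψ ξ) x‖ ^ 2)
      ≤ ∫⁻ x : RdPow d n, ENNReal.ofReal A ^ 2 * B * ∫⁻ t, ENNReal.ofReal P *
          ((ENNReal.ofReal ((1 + ‖t‖) ^ (2 * ∑ j ∈ J, s j)) * ‖h t‖ₑ ^ 2) *
          ENNReal.ofReal ((1 + ‖x + l • diagEmbedding J t‖) ^ (S - r))) := by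
        refine lintegral_mono fun x => ?_
        rw [ENNReal.ofReal_mul (Finset.prod_nonneg fun j _ => by positivity),
          ENNReal.ofReal_pow (norm_nonneg _), ofReal_norm]
        refine (mul_le_mul_right (hpt x) _).trans ?_
        rw [mul_left_comm]
        refine mul_le_mul_right ?_ _
        rw [← lintegral_const_mul _ (by fun_prop)]
        exact lintegral_mono fun t => hW x t
    _ = ENNReal.ofReal A ^ 2 * B * ∫⁻ t, ∫⁻ x : RdPow d n, ENNReal.ofReal P *
          ((ENNReal.ofReal ((1 + ‖t‖) ^ (2 * ∑ j ∈ J, s j)) * ‖h t‖ₑ ^ 2) *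
          ENNReal.ofReal ((1 + ‖x + l • diagEmbedding J t‖) ^ (S - r))) := by
        rw [lintegral_const_mul' _ _ (ENNReal.mul_lt_top
          (ENNReal.pow_lt_top ENNReal.ofReal_lt_top) hBtop).ne, lintegral_lintegral_swap (by fun_prop)]
    _ = _ := by
        have h3 : ∀ t : Rd d, ∫⁻ x : RdPow d n, ENNReal.ofReal P *
          ((ENNReal.ofReal ((1 + ‖t‖) ^ (2 * ∑ j ∈ J, s j)) * ‖h t‖ₑ ^ 2) *
          ENNReal.ofReal ((1 + ‖x + l • diagEmbedding J t‖) ^ (S - r))) =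
          ENNReal.ofReal P * Q * (ENNReal.ofReal ((1 + ‖t‖) ^ (2 * ∑ j ∈ J, s j)) * ‖h t‖ₑ ^ 2) := by
          intro t
          rw [lintegral_const_mul _ (by fun_prop), lintegral_const_mul _ (by fun_prop),
            lintegral_add_right_eq_self (fun y : RdPow d n => ENNReal.ofReal ((1 + ‖y‖) ^ (S - r)))]
          ring
        simp_rw [h3]
        rw [lintegral_const_mul _ (by fun_prop), hK]
        ring

theorem productSobolevNorm_zero {d n : ℕ} (s : Fin n → ℝ) :
    productSobolevNorm s (fun _ : RdPow d n => 0) = 0 := by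
  have : 𝓕 (fun _ : RdPow d n => (0 : ℂ)) = fun _ => 0 := by
    ext x; simp [Real.fourier_eq]
  simp [productSobolevNorm, this]

theorem exists_schwartzMap_dilate_mul_fourier {V : Type*} [NormedAddCommGroup V]
    [InnerProductSpace ℝ V] [FiniteDimensional ℝ V] [MeasurableSpace V] [BorelSpace V]
    {X : V → ℂ} (hX : ContDiff ℝ ((⊤ : ℕ∞) : WithTop ℕ∞) X) (hXc : HasCompactSupport X) (φ : 𝓢(V, ℂ)) {l : ℝ}
    (hl : l ≠ 0) :
    ∃ Ψ : 𝓢(V, ℂ), ∀ ξ, Ψ ξ = X (l • ξ) * 𝓕 (φ : V → ℂ) ξ := by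
  have h1 : HasCompactSupport fun ξ => X (l • ξ) := hXc.comp_smul hl
  have h2 : ContDiff ℝ ((⊤ : ℕ∞) : WithTop ℕ∞) fun ξ => X (l • ξ) := hX.comp (contDiff_const_smul l)
  refine ⟨SchwartzMap.smulLeftCLM ℂ (h1.toSchwartzMap h2) (𝓕 φ), fun ξ => ?_⟩
  rw [SchwartzMap.smulLeftCLM_apply_apply (SchwartzMap.hasTemperateGrowth _), SchwartzMap.fourier_coe]
  rfl

/-- `X` lives in an annulus `ρ ≤ |ξ| ≤ r`, so all but finitely many dyadic pieces vanish, and the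
sum of the constants of the others serves for the supremum. -/
theorem exists_hormanderNorm_diagMultiplier_le {d n : ℕ} {φ : 𝓢(RdPow d n, ℂ)}
    (hφ : IsDyadicPartition φ) {J : Finset (Fin n)} (hJ : J.Nonempty) {s : Fin n → ℝ}
    (hs : ∀ j, 0 < s j) {X : RdPow d n → ℂ} (hX : ContDiff ℝ ((⊤ : ℕ∞) : WithTop ℕ∞) X) (hXc : HasCompactSupport X)
    {ρ : ℝ} (hρ : 0 < ρ) (hX0 : ∀ ξ, ‖ξ‖ < ρ → X ξ = 0) :
    ∃ C : ℝ≥0, ∀ h : Rd d → ℂ, Measurable h → Integrable h →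
      hormanderNorm φ s (fun ξ => diagMultiplier J h ξ * X ξ) ≤
        C * (∫⁻ t, ENNReal.ofReal ((1 + ‖t‖) ^ (2 * ∑ j ∈ J, s j)) * ‖h t‖ₑ ^ 2) ^ (1 / 2 : ℝ) := by
  have hk : ∀ k : ℤ, ∃ C : ℝ≥0, ∀ h : Rd d → ℂ, Measurable h → Integrable h →
      productSobolevNorm s (fun ξ => (diagMultiplier J h ((2 : ℝ) ^ k • ξ) * X ((2 : ℝ) ^ k • ξ)) *
        𝓕 (φ : RdPow d n → ℂ) ξ) ≤
        C * (∫⁻ t, ENNReal.ofReal ((1 + ‖t‖) ^ (2 * ∑ j ∈ J, s j)) * ‖h t‖ₑ ^ 2) ^ (1 / 2 : ℝ) := by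
    intro k
    have hk0 : (0 : ℝ) < 2 ^ k := by positivity
    obtain ⟨Ψ, hΨ⟩ := exists_schwartzMap_dilate_mul_fourier hX hXc φ hk0.ne'
    obtain ⟨C, hC⟩ := exists_productSobolevNorm_diagMultiplier_le hJ hs Ψ hk0
    refine ⟨C, fun h hm hi => ?_⟩
    convert hC h hm hi using 3 with ξ
    rw [hΨ, mul_assoc]
  choose C hC using hk
  obtain ⟨r, hr⟩ : ∃ r : ℝ, ∀ ξ, r < ‖ξ‖ → X ξ = 0 := by
    obtain ⟨r, hr⟩ := hXc.isBounded.exists_norm_le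
    refine ⟨r, fun ξ hξ => by_contra fun h => ?_⟩
    exact absurd (hr ξ (subset_tsupport _ h)) (not_le.2 hξ)
  -- For `1/2 ≤ |ξ| ≤ 2`, the condition `ρ ≤ 2ᵏ|ξ| ≤ r` forces `ρ/2 ≤ 2ᵏ ≤ 2r`.
  obtain ⟨N, hN⟩ := pow_unbounded_of_one_lt (max (2 * r) (2 / ρ)) (one_lt_two)
  have hN1 : 2 * r < 2 ^ N := (le_max_left _ _).trans_lt hN
  have hN2 : 2 / ρ < 2 ^ N := (le_max_right _ _).trans_lt hN
  have hzero : ∀ k : ℤ, k ∉ Finset.Icc (-(N : ℤ)) N → ∀ ξ,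
      X ((2 : ℝ) ^ k • ξ) * 𝓕 (φ : RdPow d n → ℂ) ξ = 0 := by
    intro k hk ξ
    by_contra hne
    obtain ⟨hXne, hφne⟩ := mul_ne_zero_iff.1 hne
    have hann := hφ.supp (subset_tsupport _ hφne)
    simp only [Set.mem_ofPred_eq] at hann
    have h1 : ρ ≤ ‖(2 : ℝ) ^ k • ξ‖ := not_lt.1 fun h => hXne (hX0 _ h)
    have h2 : ‖(2 : ℝ) ^ k • ξ‖ ≤ r := not_lt.1 fun h => hXne (hr _ h)
    have hk0 : (0 : ℝ) < 2 ^ k := by positivity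
    rw [norm_smul, Real.norm_of_nonneg hk0.le] at h1 h2
    apply hk
    rw [Finset.mem_Icc]
    constructor
    · by_contra hlt
      have h3 : (2 : ℝ) ^ k ≤ 2 ^ (-(N : ℤ)) := zpow_le_zpow_right₀ (by norm_num) (by omega)
      rw [zpow_neg, zpow_natCast] at h3
      have h4 : (2 ^ N : ℝ)⁻¹ < ρ / 2 := by
        rw [inv_lt_comm₀ (by positivity) (by positivity), inv_div]; exact hN2
      nlinarith
    · by_contra hlt
      have h3 : (2 : ℝ) ^ (N : ℤ) ≤ 2 ^ k := zpow_le_zpow_right₀ (by norm_num) (by omega)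
      rw [zpow_natCast] at h3
      nlinarith
  refine ⟨∑ k ∈ Finset.Icc (-(N : ℤ)) N, C k, fun h hm hi => iSup_le fun k => ?_⟩
  by_cases hk : k ∈ Finset.Icc (-(N : ℤ)) N
  · refine (hC k h hm hi).trans ?_
    gcongr
    exact Finset.single_le_sum (f := C) (fun _ _ => zero_le) hk
  · have : (fun ξ => (diagMultiplier J h ((2 : ℝ) ^ k • ξ) * X ((2 : ℝ) ^ k • ξ)) *
        𝓕 (φ : RdPow d n → ℂ) ξ) = fun _ => 0 := by
      ext ξ; rw [mul_assoc, hzero k hk, mul_zero]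
    rw [this, productSobolevNorm_zero]
    exact zero_le

/-! ### The frequency cutoff and the basic modulated bump -/

/-- A smooth cutoff on `(ℝᵈ)ⁿ` that is `1` on the product of the balls of radius `1/4` about `e`. -/
theorem exists_cutoff_RdPow {d n : ℕ} (hn : 0 < n) {e : Rd d} (he : ‖e‖ = 1) :
    ∃ X : RdPow d n → ℂ, ContDiff ℝ ((⊤ : ℕ∞) : WithTop ℕ∞) X ∧ HasCompactSupport X ∧
      (∃ ρ > 0, ∀ ξ, ‖ξ‖ < ρ → X ξ = 0) ∧ (∀ ξ, ‖X ξ‖ ≤ 1) ∧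
      ∀ ξ : RdPow d n, (∀ k, ‖ξ k - e‖ ≤ 1 / 4) → X ξ = 1 := by
  set E : RdPow d n := WithLp.toLp 2 fun _ => e with hE
  have hn' : (0 : ℝ) < n := by exact_mod_cast hn
  have hEn : ‖E‖ = √n := by
    rw [PiLp.norm_eq_of_L2]; simp [hE, he]
  -- The product of the balls of radius `1/4` lies within `√n/4` of `E`, and `‖E‖ = √n`, so the
  -- outer radius `√n/2` keeps the support away from the origin.
  set b : ContDiffBump E := ⟨√n / 4, √n / 2, by positivity, by
    have : 0 < √n := by positivity
    linarith⟩ with hb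
  refine ⟨fun ξ => (b ξ : ℂ), ?_, ?_, ⟨√n / 2, by positivity, fun ξ hξ => ?_⟩, fun ξ => ?_,
    fun ξ hξ => ?_⟩
  · exact Complex.ofRealCLM.contDiff.comp b.contDiff
  · exact b.hasCompactSupport.comp_left (g := fun x : ℝ => (x : ℂ)) (by simp)
  · have : b ξ = 0 := by
      apply b.zero_of_le_dist
      rw [dist_eq_norm]
      have h1 := norm_sub_norm_le E ξ
      rw [norm_sub_rev, hEn] at h1
      have : b.rOut = √n / 2 := rfl
      rw [this]
      linarith
    simp [this]
  · rw [Complex.norm_real, Real.norm_of_nonneg b.nonneg]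
    exact b.le_one
  · have : b ξ = 1 := by
      apply b.one_of_mem_closedBall
      have h4 : b.rIn = √n / 4 := rfl
      rw [Metric.mem_closedBall, dist_eq_norm, h4, PiLp.norm_eq_of_L2]
      have h5 : ∑ i, ‖(ξ - E) i‖ ^ 2 ≤ n * (1 / 4) ^ 2 := by
        have : ∀ i ∈ Finset.univ, ‖(ξ - E) i‖ ^ 2 ≤ (1 / 4 : ℝ) ^ 2 := fun i _ => by
          gcongr; exact hξ i
        simpa using Finset.sum_le_sum this
      refine (Real.sqrt_le_sqrt h5).trans_eq ?_
      rw [Real.sqrt_mul hn'.le, Real.sqrt_sq (by norm_num)]; ring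
    simp [this]

/-- A band-limited Schwartz function which is a modulation of a nonnegative function. -/
theorem exists_modulated_nonneg_schwartzMap {d : ℕ} (e : Rd d) :
    ∃ (b : 𝓢(Rd d, ℂ)) (B : Rd d → ℝ) (c δ : ℝ), 0 < c ∧ 0 < δ ∧ δ ≤ 1 ∧
      (∀ x, b x = 𝐞 (inner ℝ x e) • (B x : ℂ)) ∧ (∀ x, 0 ≤ B x) ∧ (∀ x, ‖x‖ ≤ δ → c ≤ B x) ∧
      ∀ ξ, 𝓕 (b : Rd d → ℂ) ξ ≠ 0 → ‖ξ - e‖ ≤ 1 / 4 := by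
  -- The function will be the square of `𝓕⁻ r`, with `r` a bump centred at `e/2`: squaring moves the
  -- frequency centre to `e` and doubles the radius `1/8` to `1/4`.
  set e' : Rd d := (1 / 2 : ℝ) • e with he'
  set ρ : ContDiffBump (0 : Rd d) := ⟨1 / 16, 1 / 8, by norm_num, by norm_num⟩ with hρ
  have hρc : HasCompactSupport fun ξ => ((ρ (ξ - e') : ℝ) : ℂ) := by
    have h1 : HasCompactSupport fun ξ => ρ (ξ - e') :=
      ρ.hasCompactSupport.comp_homeomorph (Homeomorph.subRight e')
    exact h1.comp_left (g := fun x : ℝ => (x : ℂ)) (by simp)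
  have hρs : ContDiff ℝ ((⊤ : ℕ∞) : WithTop ℕ∞) fun ξ => ((ρ (ξ - e') : ℝ) : ℂ) :=
    Complex.ofRealCLM.contDiff.comp (ρ.contDiff.comp (contDiff_id.sub contDiff_const))
  set r : 𝓢(Rd d, ℂ) := hρc.toSchwartzMap hρs with hr
  have hrx : ∀ ξ, r ξ = ((ρ (ξ - e') : ℝ) : ℂ) := fun ξ => rfl
  set M := ContinuousLinearMap.mul ℂ ℂ with hM
  set q : 𝓢(Rd d, ℂ) := SchwartzMap.convolution M r r with hq
  set β : Rd d → ℂ := fun x => ∫ v : Rd d, 𝐞 (inner ℝ v x) • ((ρ v : ℝ) : ℂ) with hβ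
  have hβF : ∀ x, 𝓕⁻ (r : Rd d → ℂ) x = 𝐞 (inner ℝ e' x) • β x := by
    intro x
    rw [Real.fourierInv_eq, ← integral_add_right_eq_self _ e', hβ, Circle.smul_def,
      ← integral_smul]
    congr 1; ext v
    rw [hrx, add_sub_cancel_right, inner_add_left, AddChar.map_add_eq_mul]
    simp only [Circle.smul_def, smul_eq_mul, Circle.coe_mul]
    ring
  -- `ρ` is real and even, so its inverse Fourier transform `β` is real and `β²` is nonnegative.
  have hβreal : ∀ x, ((β x).re : ℂ) = β x := by
    intro x
    rw [← Complex.conj_eq_iff_re, hβ, ← integral_conj, ← integral_neg_eq_self]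
    congr 1; ext v
    simp only [Circle.smul_def, smul_eq_mul, map_mul, Complex.conj_ofReal, inner_neg_left, ρ.neg]
    congr 1
    rw [← Circle.coe_inv_eq_conj, ← AddChar.map_neg_eq_inv, neg_neg]
  have hb : ∀ x, (𝓕⁻ q : 𝓢(Rd d, ℂ)) x = (𝓕⁻ (r : Rd d → ℂ) x) ^ 2 := by
    intro x
    rw [SchwartzMap.fourierInv_coe, Real.fourierInv_eq_fourier_neg, ← SchwartzMap.fourier_coe, hq,
      SchwartzMap.fourier_convolution, SchwartzMap.pairing_apply_apply, Real.fourierInv_eq_fourier_neg,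
      SchwartzMap.fourier_coe, hM, ContinuousLinearMap.mul_apply', sq]
  have hβcont : Continuous β := by
    have : β = fun x => 𝐞 (-(inner ℝ e' x)) • (𝓕⁻ r : 𝓢(Rd d, ℂ)) x := by
      ext x
      rw [SchwartzMap.fourierInv_coe, hβF, smul_smul, ← AddChar.map_add_eq_mul]
      simp
    rw [this]
    have h1 : Continuous fun x : Rd d => (𝐞 (-(inner ℝ e' x)) : Circle) :=
      Real.continuous_fourierChar.comp (by fun_prop)
    exact h1.smul (SchwartzMap.continuous _)
  have hBcont : Continuous fun x => (β x).re ^ 2 := (Complex.continuous_re.comp hβcont).pow 2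
  have hβ0 : β 0 = ((∫ v, ρ v : ℝ) : ℂ) := by
    rw [hβ]; simp [integral_complex_ofReal]
  have hpos : 0 < (β 0).re ^ 2 := by
    rw [hβ0, Complex.ofReal_re]
    exact pow_pos ρ.integral_pos 2
  obtain ⟨δ, hδ, hδB⟩ := Metric.continuousAt_iff.1 hBcont.continuousAt _ (half_pos hpos)
  refine ⟨𝓕⁻ q, fun x => (β x).re ^ 2, (β 0).re ^ 2 / 2, min (δ / 2) 1, half_pos hpos,
    by positivity, min_le_right _ _, fun x => ?_, fun x => sq_nonneg _, fun x hx => ?_,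
    fun ξ hξ => ?_⟩
  · rw [hb, hβF]
    push_cast
    rw [hβreal, Circle.smul_def, Circle.smul_def, smul_eq_mul, smul_eq_mul, mul_pow]
    congr 1
    rw [← Circle.coe_pow, ← AddChar.map_nsmul_eq_pow, he', inner_smul_left, real_inner_comm]
    congr 2
    simp
  · have h1 : ‖x‖ ≤ δ / 2 := hx.trans (min_le_left _ _)
    have h2 := hδB (x := x) (by rw [dist_zero_right]; linarith)
    rw [Real.dist_eq] at h2
    have := (abs_lt.1 h2).1
    linarith
  · rw [← SchwartzMap.fourier_coe, FourierTransform.fourier_fourierInv_eq, hq,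
      SchwartzMap.convolution_apply] at hξ
    have hmem := support_convolution_subset M (Function.mem_support.2 hξ)
    have hsupp : ∀ y, r y ≠ 0 → ‖y - e'‖ ≤ 1 / 8 := by
      intro y hy
      rw [hrx, Complex.ofReal_ne_zero] at hy
      have h1 : y - e' ∈ Function.support ρ := hy
      rw [ρ.support_eq, Metric.mem_ball, dist_zero_right] at h1
      exact h1.le
    obtain ⟨u, hu, v, hv, rfl⟩ := Set.mem_add.1 hmem
    have h1 := hsupp u hu
    have h2 := hsupp v hv
    have h3 : u + v - e = (u - e') + (v - e') := by
      have : e = e' + e' := by rw [he', ← add_smul]; norm_num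
      nth_rewrite 1 [this]; abel
    rw [h3]
    refine (norm_add_le _ _).trans ?_
    linarith

/-! ### Maximal functions of functions with frequencies away from the origin -/

section Schwartz

variable {V : Type*} [NormedAddCommGroup V] [InnerProductSpace ℝ V]

/-- The products of the dilates `u(t·)` with a Schwartz function vanishing near the origin form a
bounded family of Schwartz functions. -/
theorem exists_dilate_mul_decay (u v : 𝓢(V, ℂ)) (hv : ∀ ξ, ‖ξ‖ < 1 / 2 → v ξ = 0) (k n : ℕ) :
    ∃ C : ℝ, 0 ≤ C ∧ ∀ t : ℝ, 0 < t → ∀ ξ,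
      ‖ξ‖ ^ k * ‖iteratedFDeriv ℝ n (fun ξ => u (t • ξ) * v ξ) ξ‖ ≤ C := by
  set C : ℝ := ∑ i ∈ Finset.range (n + 1), (n.choose i : ℝ) *
    (2 ^ i * SchwartzMap.seminorm ℝ i i u) * SchwartzMap.seminorm ℝ k (n - i) v with hC
  have hC0 : 0 ≤ C := Finset.sum_nonneg fun i _ => by positivity
  refine ⟨C, hC0, fun t ht ξ => ?_⟩
  rcases lt_or_ge ‖ξ‖ (1 / 2) with hξ | hξ
  · have h0 : (fun ξ => u (t • ξ) * v ξ) =ᶠ[nhds ξ] fun _ => 0 := by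
      filter_upwards [(isOpen_lt continuous_norm continuous_const).mem_nhds hξ] with η hη
      rw [hv η hη, mul_zero]
    rw [(h0.iteratedFDeriv ℝ n).eq_of_nhds]
    have : iteratedFDeriv ℝ n (fun _ : V => (0 : ℂ)) ξ = 0 := by
      rw [iteratedFDeriv_fun_zero]; rfl
    rw [this, norm_zero, mul_zero]
    exact hC0
  · have hus : ContDiff ℝ n fun ξ => u (t • ξ) := (u.smooth n).comp (contDiff_const_smul t)
    have h1 := norm_iteratedFDeriv_mul_le hus (v.smooth n) ξ (le_refl (n : WithTop ℕ∞))
    calc ‖ξ‖ ^ k * ‖iteratedFDeriv ℝ n (fun ξ => u (t • ξ) * v ξ) ξ‖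
        ≤ ‖ξ‖ ^ k * ∑ i ∈ Finset.range (n + 1), (n.choose i : ℝ) *
          ‖iteratedFDeriv ℝ i (fun ξ => u (t • ξ)) ξ‖ * ‖iteratedFDeriv ℝ (n - i) v ξ‖ := by gcongr
      _ ≤ C := by
        rw [Finset.mul_sum]
        refine Finset.sum_le_sum fun i _ => ?_
        have h2 : ‖iteratedFDeriv ℝ i (fun ξ => u (t • ξ)) ξ‖ ≤ 2 ^ i * SchwartzMap.seminorm ℝ i i u := by
          rw [iteratedFDeriv_comp_const_smul t (u.smooth i), norm_smul, norm_pow,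
            Real.norm_of_nonneg ht.le]
          have h3 := SchwartzMap.le_seminorm ℝ i i u (t • ξ)
          rw [norm_smul, Real.norm_of_nonneg ht.le] at h3
          -- Each derivative of `u(t·)` costs a factor `t`. Since `|ξ| ≥ 1/2`, `t ≤ 2|tξ|`, and the
          -- decay of `u` pays for it uniformly in `t`.
          calc t ^ i * ‖iteratedFDeriv ℝ i u (t • ξ)‖
              ≤ (2 * (t * ‖ξ‖)) ^ i * ‖iteratedFDeriv ℝ i u (t • ξ)‖ := by
                gcongr; nlinarith
            _ = 2 ^ i * ((t * ‖ξ‖) ^ i * ‖iteratedFDeriv ℝ i u (t • ξ)‖) := by rw [mul_pow]; ring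
            _ ≤ _ := by gcongr
        have h4 := SchwartzMap.le_seminorm ℝ k (n - i) v ξ
        calc ‖ξ‖ ^ k * ((n.choose i : ℝ) * ‖iteratedFDeriv ℝ i (fun ξ => u (t • ξ)) ξ‖ *
              ‖iteratedFDeriv ℝ (n - i) v ξ‖)
            = (n.choose i : ℝ) * ‖iteratedFDeriv ℝ i (fun ξ => u (t • ξ)) ξ‖ *
              (‖ξ‖ ^ k * ‖iteratedFDeriv ℝ (n - i) v ξ‖) := by ring
          _ ≤ _ := by gcongr

/-- The inverse Fourier transform is continuous on Schwartz space, hence maps the bounded family of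
`exists_dilate_mul_decay` to a bounded family. Uniformity in `t` is what controls the supremum in
the Hardy norm. -/
theorem exists_norm_fourierInv_dilate_mul_le [FiniteDimensional ℝ V]
    [MeasurableSpace V] [BorelSpace V] (u v : 𝓢(V, ℂ)) (hv : ∀ ξ, ‖ξ‖ < 1 / 2 → v ξ = 0)
    (r : ℝ) :
    ∃ C : ℝ, 0 ≤ C ∧ ∀ t : ℝ, 0 < t → ∀ x,
      ‖𝓕⁻ (fun ξ => u (t • ξ) * v ξ) x‖ ≤ C * (1 + ‖x‖) ^ (-r) := by
  choose D hD0 hD using exists_dilate_mul_decay u v hv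
  obtain ⟨N, hN⟩ := exists_nat_ge r
  set q : Seminorm ℝ 𝓢(V, ℂ) := ((Finset.Iic (N, 0)).sup (schwartzSeminormFamily ℝ V ℂ)) with hq
  have hqc : Continuous q :=
    Seminorm.continuous_finsetSup (s := Finset.Iic (N, 0))
      fun i _ => (schwartz_withSeminorms ℝ V ℂ).continuous_seminorm i
  let F : 𝓢(V, ℂ) →L[ℝ] 𝓢(V, ℂ) := FourierTransform.fourierInvCLM ℝ 𝓢(V, ℂ)
  obtain ⟨S, K, -, hK⟩ := Seminorm.bound_of_continuous (schwartz_withSeminorms ℝ V ℂ)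
    (q.comp F.toLinearMap) (hqc.comp F.continuous)
  refine ⟨2 ^ N * (K * ∑ i ∈ S, D i.1 i.2), ?_, fun t ht x => ?_⟩
  · have : 0 ≤ ∑ i ∈ S, D i.1 i.2 := Finset.sum_nonneg fun i _ => hD0 _ _
    positivity
  let g : 𝓢(V, ℂ) := ⟨fun ξ => u (t • ξ) * v ξ,
    ((u.smooth ⊤).comp (contDiff_const_smul t)).mul (v.smooth ⊤),
    fun k n => ⟨D k n, fun ξ => hD k n t ht ξ⟩⟩
  have h1 : 𝓕⁻ (fun ξ => u (t • ξ) * v ξ) x = F g x := by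
    change _ = (𝓕⁻ g : 𝓢(V, ℂ)) x
    rw [SchwartzMap.fourierInv_coe]; rfl
  rw [h1]
  refine ((F g).norm_le_one_add_norm_rpow hN x).trans ?_
  gcongr
  refine (hK g).trans ?_
  rw [smul_apply, NNReal.smul_def, smul_eq_mul]
  gcongr
  refine Seminorm.finset_sup_apply_le (Finset.sum_nonneg fun i _ => hD0 _ _) fun i hi => ?_
  refine le_trans ?_ (Finset.single_le_sum (f := fun i : ℕ × ℕ => D i.1 i.2)
    (fun i _ => hD0 _ _) hi)
  exact SchwartzMap.seminorm_le_bound ℝ i.1 i.2 g (hD0 _ _) fun ξ => hD i.1 i.2 t ht ξ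

end Schwartz

theorem fourier_dilate {d : ℕ} (Φ : Rd d → ℂ) {t : ℝ} (ht : 0 < t) (ξ : Rd d) :
    𝓕 (fun y => (((t ^ d)⁻¹ : ℝ) : ℂ) * Φ (t⁻¹ • y)) ξ = 𝓕 Φ (t • ξ) := by
  rw [Real.fourier_eq, Real.fourier_eq]
  have h := Measure.integral_comp_smul (volume : Measure (Rd d))
    (fun v => 𝐞 (-(inner ℝ v (t • ξ))) • Φ v) t⁻¹
  simp only [finrank_euclideanSpace, Fintype.card_fin] at h
  have h2 : ∀ v : Rd d, inner ℝ (t⁻¹ • v) (t • ξ) = inner ℝ v ξ := fun v => by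
    rw [inner_smul_left, inner_smul_right]; simp [ht.ne']
  simp only [h2] at h
  have h3 : ∀ v : Rd d, 𝐞 (-(inner ℝ v ξ)) • ((((t ^ d)⁻¹ : ℝ) : ℂ) * Φ (t⁻¹ • v)) =
      (t ^ d)⁻¹ • (𝐞 (-(inner ℝ v ξ)) • Φ (t⁻¹ • v)) := fun v => by
    simp only [Circle.smul_def, smul_eq_mul, Complex.real_smul]; ring
  simp only [h3]
  rw [integral_smul, h, smul_smul, inv_pow, inv_inv, abs_of_pos (by positivity),
    inv_mul_cancel₀ (by positivity), one_smul]

theorem integral_dilate_mul_eq {d : ℕ} (Φ f : 𝓢(Rd d, ℂ)) {t : ℝ} (ht : 0 < t) (x : Rd d) :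
    ∫ y : Rd d, (((t ^ d)⁻¹ : ℝ) : ℂ) * Φ (t⁻¹ • (x - y)) * f y =
      𝓕⁻ (fun ξ => 𝓕 (Φ : Rd d → ℂ) (t • ξ) * 𝓕 (f : Rd d → ℂ) ξ) x := by
  have hG : Integrable fun y => (((t ^ d)⁻¹ : ℝ) : ℂ) * Φ (t⁻¹ • y) :=
    (Φ.integrable.comp_smul (inv_ne_zero ht.ne')).const_mul _
  have hf : Integrable (𝓕 (f : Rd d → ℂ)) := by
    rw [← SchwartzMap.fourier_coe]; exact (𝓕 f).integrable
  have h := fourierInv_fourier_mul hG hf x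
  simp only [fourier_dilate _ ht] at h
  rw [h, ← integral_sub_left_eq_self _ volume x]
  have h3 : 𝓕⁻ (𝓕 (f : Rd d → ℂ)) = f := by
    rw [← SchwartzMap.fourier_coe, ← SchwartzMap.fourierInv_coe,
      FourierTransform.fourierInv_fourier_eq]
  simp only [sub_sub_cancel, h3]

/-- Pointwise control of the radial maximal function of Schwartz functions whose Fourier transform
is `Ĝ b̂`, where `b̂` vanishes near the origin. -/
theorem exists_maximal_le {d : ℕ} (Φ b : 𝓢(Rd d, ℂ))
    (hb : ∀ ξ, ‖ξ‖ < 1 / 2 → 𝓕 (b : Rd d → ℂ) ξ = 0) (r : ℝ) :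
    ∃ C : ℝ≥0, (∀ t : ℝ, 0 < t → ∀ x,
      ‖∫ y : Rd d, (((t ^ d)⁻¹ : ℝ) : ℂ) * Φ (t⁻¹ • (x - y)) * b y‖ₑ ≤
        C * ENNReal.ofReal ((1 + ‖x‖) ^ (-r))) ∧
      ∀ (G : Rd d → ℂ) (f : 𝓢(Rd d, ℂ)), Integrable G →
        (∀ ξ, 𝓕 (f : Rd d → ℂ) ξ = 𝓕 G ξ * 𝓕 (b : Rd d → ℂ) ξ) → ∀ t : ℝ, 0 < t → ∀ x,
        ‖∫ y : Rd d, (((t ^ d)⁻¹ : ℝ) : ℂ) * Φ (t⁻¹ • (x - y)) * f y‖ₑ ≤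
          C * ∫⁻ y, ‖G y‖ₑ * ENNReal.ofReal ((1 + ‖x - y‖) ^ (-r)) := by
  obtain ⟨C, hC0, hC⟩ := exists_norm_fourierInv_dilate_mul_le (𝓕 Φ) (𝓕 b) hb r
  simp only [SchwartzMap.fourier_coe] at hC
  have hC' : ∀ t : ℝ, 0 < t → ∀ x,
      ‖𝓕⁻ (fun ξ => 𝓕 (Φ : Rd d → ℂ) (t • ξ) * 𝓕 (b : Rd d → ℂ) ξ) x‖ₑ ≤
        C.toNNReal * ENNReal.ofReal ((1 + ‖x‖) ^ (-r)) := by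
    intro t ht x
    rw [← ENNReal.ofReal, ← ENNReal.ofReal_mul hC0, ← ofReal_norm]
    exact ENNReal.ofReal_le_ofReal (hC t ht x)
  refine ⟨C.toNNReal, fun t ht x => ?_, fun G f hG hf t ht x => ?_⟩
  · rw [integral_dilate_mul_eq _ _ ht]
    exact hC' t ht x
  · rw [integral_dilate_mul_eq _ _ ht]
    have hg : Integrable fun ξ => 𝓕 (Φ : Rd d → ℂ) (t • ξ) * 𝓕 (b : Rd d → ℂ) ξ := by
      rw [← SchwartzMap.fourier_coe, ← SchwartzMap.fourier_coe]
      refine (𝓕 b).integrable.bdd_mul (c := (SchwartzMap.seminorm ℝ 0 0) (𝓕 Φ)) ?_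
        (Filter.Eventually.of_forall fun ξ => SchwartzMap.norm_le_seminorm ℝ _ _)
      exact ((𝓕 Φ).continuous.comp (continuous_const_smul t)).aestronglyMeasurable
    have h1 : (fun ξ => 𝓕 (Φ : Rd d → ℂ) (t • ξ) * 𝓕 (f : Rd d → ℂ) ξ) =
        fun ξ => 𝓕 G ξ * (𝓕 (Φ : Rd d → ℂ) (t • ξ) * 𝓕 (b : Rd d → ℂ) ξ) := by
      ext ξ; rw [hf]; ring
    rw [h1, fourierInv_fourier_mul hG hg]
    refine (enorm_integral_le_lintegral_enorm _).trans ?_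
    rw [← lintegral_const_mul' _ _ ENNReal.coe_ne_top]
    refine lintegral_mono fun y => ?_
    rw [enorm_mul, mul_left_comm]
    gcongr
    exact hC' t ht _

/-- `Ĝ` is smooth because `G` has compact support, and `b̂` has compact support, so `Ĝ b̂` is a test
function. Thus `G * b` is Schwartz although `G` may be discontinuous. -/
theorem exists_schwartzMap_fourier_eq_mul {d : ℕ} {b : 𝓢(Rd d, ℂ)} {e : Rd d}
    (hb : ∀ ξ, 𝓕 (b : Rd d → ℂ) ξ ≠ 0 → ‖ξ - e‖ ≤ 1 / 4) {G : Rd d → ℂ}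
    (hGi : Integrable G) (hGc : HasCompactSupport G) :
    ∃ f : 𝓢(Rd d, ℂ), (∀ ξ, 𝓕 (f : Rd d → ℂ) ξ = 𝓕 G ξ * 𝓕 (b : Rd d → ℂ) ξ) ∧
      ∀ x, f x = ∫ y, G y * b (x - y) := by
  obtain ⟨M, hM⟩ := hGc.isBounded.exists_norm_le
  have hsm : ContDiff ℝ ((⊤ : ℕ∞) : WithTop ℕ∞) (𝓕 G) := by
    refine Real.contDiff_fourier fun n _ => ?_
    refine (hGi.norm.const_mul (M ^ n)).mono
      ((by fun_prop : Continuous fun v : Rd d => ‖v‖ ^ n).aestronglyMeasurable.mul hGi.1.norm)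
      (Filter.Eventually.of_forall fun v => ?_)
    by_cases hv : G v = 0
    · simp [hv]
    · have h1 := hM v (subset_tsupport _ hv)
      have h0 := (norm_nonneg v).trans h1
      rw [Real.norm_of_nonneg (by positivity), Real.norm_of_nonneg (by positivity)]
      gcongr
  have hcs : HasCompactSupport fun ξ => 𝓕 G ξ * 𝓕 (b : Rd d → ℂ) ξ := by
    refine HasCompactSupport.intro (isCompact_closedBall e (1 / 4)) fun ξ hξ => ?_
    by_contra hne
    refine hξ ?_
    rw [Metric.mem_closedBall, dist_eq_norm]
    exact hb ξ (right_ne_zero_of_mul hne)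
  have hb' : ContDiff ℝ ((⊤ : ℕ∞) : WithTop ℕ∞) (𝓕 (b : Rd d → ℂ)) := by
    rw [← SchwartzMap.fourier_coe]; exact (𝓕 b).smooth ⊤
  set g : 𝓢(Rd d, ℂ) := hcs.toSchwartzMap (hsm.mul hb') with hg
  have hgx : (g : Rd d → ℂ) = fun ξ => 𝓕 G ξ * 𝓕 (b : Rd d → ℂ) ξ := rfl
  have hbi : Integrable (𝓕 (b : Rd d → ℂ)) := by
    rw [← SchwartzMap.fourier_coe]; exact (𝓕 b).integrable
  refine ⟨𝓕⁻ g, fun ξ => ?_, fun x => ?_⟩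
  · rw [← SchwartzMap.fourier_coe, FourierTransform.fourier_fourierInv_eq, hgx]
  · have h3 : 𝓕⁻ (𝓕 (b : Rd d → ℂ)) = b := by
      rw [← SchwartzMap.fourier_coe, ← SchwartzMap.fourierInv_coe,
        FourierTransform.fourierInv_fourier_eq]
    rw [SchwartzMap.fourierInv_coe, hgx, fourierInv_fourier_mul hGi hbi, h3]

/-! ### Power weights and their logarithmic mass -/

/-- The weight `(1 + |y|)^{-a}` truncated to the ball of radius `R`. -/
noncomputable def truncWeight {d : ℕ} (a R : ℝ) (y : Rd d) : ℝ :=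
  (Metric.closedBall (0 : Rd d) R).indicator (fun y => (1 + ‖y‖) ^ (-a)) y

/-- The weight `(1 + |y|)^{-a}` with additional decay of order `A` outside the ball of radius
`R`. -/
noncomputable def tailWeight {d : ℕ} (a A R : ℝ) (y : Rd d) : ℝ :=
  (1 + ‖y‖) ^ (-a) * (1 + ‖y‖ / R) ^ (-A)

/-- The logarithmically divergent mass `∫_{|y| ≤ R} (1 + |y|)^{-d} dy`. -/
noncomputable def logMass (d : ℕ) (R : ℝ) : ℝ≥0∞ :=
  ∫⁻ y in Metric.closedBall (0 : Rd d) R, ENNReal.ofReal ((1 + ‖y‖) ^ (-(d : ℝ)))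

theorem truncWeight_nonneg {d : ℕ} (a R : ℝ) (y : Rd d) : 0 ≤ truncWeight a R y :=
  Set.indicator_nonneg (fun _ _ => by positivity) _

theorem truncWeight_le_one {d : ℕ} {a : ℝ} (ha : 0 ≤ a) (R : ℝ) (y : Rd d) :
    truncWeight a R y ≤ 1 := by
  refine Set.indicator_apply_le' (fun _ => ?_) fun _ => zero_le_one
  exact Real.rpow_le_one_of_one_le_of_nonpos (by linarith [norm_nonneg y]) (by linarith)

theorem measurable_truncWeight {d : ℕ} (a R : ℝ) : Measurable (truncWeight a R : Rd d → ℝ) :=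
  Measurable.indicator (by fun_prop) measurableSet_closedBall

theorem truncWeight_of_mem {d : ℕ} {a R : ℝ} {y : Rd d} (hy : ‖y‖ ≤ R) :
    truncWeight a R y = (1 + ‖y‖) ^ (-a) :=
  Set.indicator_of_mem (by simpa using hy) _

theorem truncWeight_of_notMem {d : ℕ} {a R : ℝ} {y : Rd d} (hy : R < ‖y‖) :
    truncWeight a R y = 0 :=
  Set.indicator_of_notMem (by simpa using hy) _

theorem integrable_truncWeight {d : ℕ} {a : ℝ} (ha : 0 ≤ a) (R : ℝ) :
    Integrable (truncWeight a R : Rd d → ℝ) := by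
  have h : Integrable ((Metric.closedBall (0 : Rd d) R).indicator fun _ => (1 : ℝ)) :=
    (integrable_indicator_iff measurableSet_closedBall).2
      (integrableOn_const measure_closedBall_lt_top.ne)
  refine h.mono (measurable_truncWeight a R).aestronglyMeasurable
    (Filter.Eventually.of_forall fun y => ?_)
  rw [Real.norm_of_nonneg (truncWeight_nonneg a R y)]
  rcases le_or_gt ‖y‖ R with hy | hy
  · rw [Set.indicator_of_mem (by simpa using hy)]
    simpa using truncWeight_le_one ha R y
  · rw [truncWeight_of_notMem hy]; positivity

theorem tailWeight_le_one {d : ℕ} {a A R : ℝ} (ha : 0 ≤ a) (hA : 0 ≤ A) (hR : 0 < R) (y : Rd d) :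
    tailWeight a A R y ≤ 1 := by
  refine mul_le_one₀ ?_ (by positivity) ?_
  · exact Real.rpow_le_one_of_one_le_of_nonpos (by linarith [norm_nonneg y]) (by linarith)
  · refine Real.rpow_le_one_of_one_le_of_nonpos ?_ (by linarith)
    have : 0 ≤ ‖y‖ / R := by positivity
    linarith

theorem truncWeight_le_tailWeight {d : ℕ} (a : ℝ) {A R : ℝ} (hA : 0 ≤ A) (hR : 0 < R) (y : Rd d) :
    truncWeight a R y ≤ 2 ^ A * tailWeight a A R y := by
  rcases le_or_gt ‖y‖ R with hy | hy
  · rw [truncWeight_of_mem hy, tailWeight, mul_left_comm]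
    refine le_mul_of_one_le_right (by positivity) ?_
    rw [Real.rpow_neg (by positivity), ← div_eq_mul_inv, one_le_div (by positivity)]
    refine Real.rpow_le_rpow (by positivity) ?_ hA
    have : ‖y‖ / R ≤ 1 := (div_le_one hR).2 hy
    linarith
  · rw [truncWeight_of_notMem hy, tailWeight]; positivity

theorem one_add_rpow_neg_le {u v w a : ℝ} (hu : 0 ≤ u) (hv : 0 ≤ v) (hw : 0 ≤ w) (h : v ≤ u + w)
    (ha : 0 ≤ a) : (1 + u) ^ (-a) ≤ (1 + v) ^ (-a) * (1 + w) ^ a := by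
  rw [Real.rpow_neg (by positivity), Real.rpow_neg (by positivity), inv_mul_eq_div, le_div_iff₀
    (by positivity), inv_mul_le_iff₀ (by positivity), ← Real.mul_rpow (by positivity) (by positivity)]
  exact Real.rpow_le_rpow (by positivity) (by nlinarith [mul_nonneg hu hw]) ha

/-- A Peetre-type inequality, uniform in `R`: because `R ≥ 1`, rescaling by `R` only shrinks `|x -
y|`. -/
theorem tailWeight_le {d : ℕ} {a A R : ℝ} (ha : 0 ≤ a) (hA : 0 ≤ A) (hR : 1 ≤ R) (x y : Rd d) :
    tailWeight a A R y ≤ tailWeight a A R x * (1 + ‖x - y‖) ^ (a + A) := by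
  have htri : ‖x‖ ≤ ‖y‖ + ‖x - y‖ := by
    have := norm_add_le y (x - y); rwa [add_sub_cancel] at this
  have hR0 : 0 < R := by linarith
  have h1 := one_add_rpow_neg_le (norm_nonneg y) (norm_nonneg x) (norm_nonneg (x - y)) htri ha
  have h2 := one_add_rpow_neg_le (u := ‖y‖ / R) (v := ‖x‖ / R) (w := ‖x - y‖) (by positivity)
    (by positivity) (norm_nonneg (x - y)) (by
      calc ‖x‖ / R ≤ (‖y‖ + ‖x - y‖) / R := by gcongr
        _ = ‖y‖ / R + ‖x - y‖ / R := add_div _ _ _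
        _ ≤ _ := by gcongr; exact div_le_self (norm_nonneg _) hR) hA
  rw [tailWeight, tailWeight, Real.rpow_add (by positivity)]
  calc _ ≤ ((1 + ‖x‖) ^ (-a) * (1 + ‖x - y‖) ^ a) *
        ((1 + ‖x‖ / R) ^ (-A) * (1 + ‖x - y‖) ^ A) := by gcongr
    _ = _ := by ring

/-- Of the decay `a + A + (d + 1)`, the part `a + A` pays for moving the weight from `y` to `x`, and
the remaining `d + 1` is integrable. -/
theorem exists_lintegral_truncWeight_le {d : ℕ} {a A : ℝ} (ha : 0 ≤ a) (hA : 0 ≤ A) :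
    ∃ C : ℝ≥0, ∀ R : ℝ, 1 ≤ R → ∀ x : Rd d,
      ∫⁻ y, ENNReal.ofReal (truncWeight a R y) *
        ENNReal.ofReal ((1 + ‖x - y‖) ^ (-(a + A + (d + 1)))) ≤
        C * ENNReal.ofReal (tailWeight a A R x) := by
  set K : ℝ≥0∞ := ∫⁻ u : Rd d, ENNReal.ofReal ((1 + ‖u‖) ^ (-((d : ℝ) + 1))) with hK
  have hKtop : K < ∞ := lintegral_one_add_norm_rpow_lt_top _ (by simp)
  refine ⟨(ENNReal.ofReal (2 ^ A) * K).toNNReal, fun R hR x => ?_⟩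
  rw [ENNReal.coe_toNNReal (ENNReal.mul_lt_top ENNReal.ofReal_lt_top hKtop).ne]
  calc _ ≤ ∫⁻ y, ENNReal.ofReal (2 ^ A) * ENNReal.ofReal (tailWeight a A R x) *
        ENNReal.ofReal ((1 + ‖x - y‖) ^ (-((d : ℝ) + 1))) := by
        refine lintegral_mono fun y => ?_
        rw [← ENNReal.ofReal_mul (truncWeight_nonneg _ _ _), ← ENNReal.ofReal_mul (by positivity),
          ← ENNReal.ofReal_mul (by unfold tailWeight; positivity)]
        refine ENNReal.ofReal_le_ofReal ?_
        calc _ ≤ (2 ^ A * (tailWeight a A R x * (1 + ‖x - y‖) ^ (a + A))) *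
              (1 + ‖x - y‖) ^ (-(a + A + (d + 1))) := by
              gcongr
              refine (truncWeight_le_tailWeight a hA (by linarith) y).trans ?_
              gcongr
              exact tailWeight_le ha hA hR x y
          _ = 2 ^ A * tailWeight a A R x * ((1 + ‖x - y‖) ^ (a + A) *
              (1 + ‖x - y‖) ^ (-(a + A + (d + 1)))) := by ring
          _ = _ := by
              rw [← Real.rpow_add (by positivity)]
              congr 2; ring
    _ = _ := by
        rw [lintegral_const_mul _ (by fun_prop), lintegral_sub_left_eq_self
          (fun u : Rd d => ENNReal.ofReal ((1 + ‖u‖) ^ (-((d : ℝ) + 1)))) x]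
        ring

/-- Only `|y - x| ≤ δ` is kept: there `|y| ≤ R/2 + 1 ≤ R`, and `1 + |y| ≤ 2(1 + |x|)`. -/
theorem exists_le_lintegral_truncWeight {d : ℕ} {a δ : ℝ} (ha : 0 ≤ a) (hδ : 0 < δ) (hδ1 : δ ≤ 1)
    {c : ℝ≥0∞} (hc : c ≠ 0) :
    ∃ C : ℝ≥0∞, C ≠ 0 ∧ ∀ K : Rd d → ℝ≥0∞, (∀ y, ‖y‖ ≤ δ → c ≤ K y) → ∀ R : ℝ, 2 ≤ R →
      ∀ x : Rd d, ‖x‖ ≤ R / 2 → C * ENNReal.ofReal ((1 + ‖x‖) ^ (-a)) ≤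
        ∫⁻ y, ENNReal.ofReal (truncWeight a R y) * K (x - y) := by
  refine ⟨ENNReal.ofReal (2 ^ (-a)) * c * volume (Metric.closedBall (0 : Rd d) δ), ?_,
    fun K hK R hR x hx => ?_⟩
  · refine mul_ne_zero (mul_ne_zero ?_ hc) (Metric.measure_closedBall_pos volume _ hδ).ne'
    simp only [ne_eq, ENNReal.ofReal_eq_zero, not_le]; positivity
  · calc _ = ∫⁻ y in Metric.closedBall x δ,
          ENNReal.ofReal (2 ^ (-a)) * ENNReal.ofReal ((1 + ‖x‖) ^ (-a)) * c := by
          rw [setLIntegral_const, Measure.addHaar_closedBall_center volume x δ]; ring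
      _ ≤ ∫⁻ y in Metric.closedBall x δ, ENNReal.ofReal (truncWeight a R y) * K (x - y) := by
          refine setLIntegral_mono' measurableSet_closedBall fun y hy => ?_
          rw [Metric.mem_closedBall, dist_eq_norm] at hy
          have hy' : ‖x - y‖ ≤ δ := by rwa [norm_sub_rev]
          have h1 : ‖y‖ ≤ ‖x‖ + 1 := by
            have := norm_add_le x (y - x); rw [add_sub_cancel] at this; linarith
          rw [truncWeight_of_mem (by linarith), ← ENNReal.ofReal_mul (by positivity)]
          gcongr
          · rw [← Real.mul_rpow (by norm_num) (by positivity)]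
            exact Real.rpow_le_rpow_of_nonpos (by positivity) (by linarith [norm_nonneg x])
              (by linarith)
          · exact hK _ hy'
      _ ≤ _ := setLIntegral_le_lintegral _ _

theorem logMass_mono (d : ℕ) {R S : ℝ} (h : R ≤ S) : logMass d R ≤ logMass d S :=
  lintegral_mono_set (Metric.closedBall_subset_closedBall h)

theorem logMass_lt_top (d : ℕ) (R : ℝ) : logMass d R < ∞ := by
  refine (setLIntegral_mono' measurableSet_closedBall (g := fun _ => 1) fun y _ => ?_).trans_lt ?_
  · rw [ENNReal.ofReal_le_one]
    exact Real.rpow_le_one_of_one_le_of_nonpos (by linarith [norm_nonneg y]) (by simp)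
  · rw [setLIntegral_const, one_mul]; exact measure_closedBall_lt_top

theorem logMass_pos (d : ℕ) {R : ℝ} (hR : 0 < R) : 0 < logMass d R := by
  rw [logMass, setLIntegral_pos_iff (by fun_prop)]
  have : Function.support (fun y : Rd d => ENNReal.ofReal ((1 + ‖y‖) ^ (-(d : ℝ)))) = Set.univ := by
    ext y
    simp only [Function.mem_support, ne_eq, ENNReal.ofReal_eq_zero, not_le, Set.mem_univ, iff_true]
    positivity
  rw [this, Set.univ_inter]
  exact Metric.measure_closedBall_pos volume _ hR

theorem logMass_le_half (d : ℕ) (R : ℝ) :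
    logMass d R ≤ ENNReal.ofReal (2 ^ (d : ℝ)) * logMass d (R / 2) := by
  classical
  rw [logMass, logMass, ← lintegral_indicator measurableSet_closedBall,
    ← lintegral_indicator measurableSet_closedBall]
  have h := lintegral_comp_smul_Rd (d := d)
    (f := (Metric.closedBall (0 : Rd d) R).indicator fun y => ENNReal.ofReal ((1 + ‖y‖) ^ (-(d : ℝ))))
    (Measurable.indicator (by fun_prop) measurableSet_closedBall) (l := 2) (by norm_num)
  have h2 : ENNReal.ofReal (2 ^ (d : ℝ)) * ENNReal.ofReal (2 ^ (-(d : ℝ))) = 1 := by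
    rw [← ENNReal.ofReal_mul (by positivity), ← Real.rpow_add (by norm_num)]; simp
  calc _ = ENNReal.ofReal (2 ^ (d : ℝ)) * (ENNReal.ofReal (2 ^ (-(d : ℝ))) * _) := by
        rw [← mul_assoc, h2, one_mul]
    _ ≤ _ := by
        rw [← h]
        refine mul_le_mul_right (lintegral_mono fun y => ?_) _
        rw [Set.indicator_apply]
        split_ifs with hy
        · rw [mem_closedBall_zero_iff, norm_smul, Real.norm_of_nonneg (by norm_num)] at hy
          rw [Set.indicator_of_mem (by rw [mem_closedBall_zero_iff]; linarith)]
          refine ENNReal.ofReal_le_ofReal (Real.rpow_le_rpow_of_nonpos (by positivity) ?_ (by simp))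
          rw [norm_smul, Real.norm_of_nonneg (by norm_num)]
          linarith [norm_nonneg y]
        · exact zero_le

theorem exists_le_logMass_sub {d : ℕ} {e : Rd d} (he : ‖e‖ = 1) :
    ∃ c : ℝ≥0∞, c ≠ 0 ∧ ∀ R : ℝ, 1 ≤ R → logMass d R + c ≤ logMass d (2 * R) := by
  refine ⟨ENNReal.ofReal (6 ^ (-(d : ℝ))) * volume (Metric.ball (0 : Rd d) 1), ?_, fun R hR => ?_⟩
  · refine mul_ne_zero ?_ (Metric.measure_ball_pos volume _ one_pos).ne'
    simp only [ne_eq, ENNReal.ofReal_eq_zero, not_le]; positivity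
  -- This ball lies in `R < |y| < 2R`, where `1 + |y| ≤ 3R`; its mass is at least `(3R)^{-d} (R/2)^d
  -- = 6^{-d}` times the volume of the unit ball, whatever `R` is.
  · set U := Metric.ball ((3 / 2 * R) • e) (R / 2) with hU
    have hcen : ‖(3 / 2 * R) • e‖ = 3 / 2 * R := by
      rw [norm_smul, he, mul_one, Real.norm_of_nonneg (by positivity)]
    have hmem : ∀ y ∈ U, R < ‖y‖ ∧ ‖y‖ < 2 * R := by
      intro y hy
      rw [hU, Metric.mem_ball, dist_eq_norm] at hy
      have h1 := norm_sub_norm_le y ((3 / 2 * R) • e)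
      have h2 := norm_sub_norm_le ((3 / 2 * R) • e) y
      rw [norm_sub_rev] at h2
      rw [hcen] at h1 h2
      constructor <;> linarith
    have hdisj : Disjoint (Metric.closedBall (0 : Rd d) R) U := by
      refine Set.disjoint_left.2 fun y hy hyU => ?_
      rw [mem_closedBall_zero_iff] at hy
      exact absurd (hmem y hyU).1 (not_lt.2 hy)
    have hsub : Metric.closedBall (0 : Rd d) R ∪ U ⊆ Metric.closedBall 0 (2 * R) := by
      refine Set.union_subset (Metric.closedBall_subset_closedBall (by linarith)) fun y hy => ?_
      rw [mem_closedBall_zero_iff]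
      exact (hmem y hy).2.le
    calc _ ≤ logMass d R + ∫⁻ y in U, ENNReal.ofReal ((1 + ‖y‖) ^ (-(d : ℝ))) := by
          gcongr
          calc _ = ∫⁻ y in U, ENNReal.ofReal ((3 * R) ^ (-(d : ℝ))) := by
                rw [setLIntegral_const, hU, Measure.addHaar_ball_of_pos volume ((3 / 2 * R) • e) (half_pos (by positivity : 0 < R)), ← mul_assoc,
                  ← ENNReal.ofReal_mul (by positivity)]
                congr 2
                simp only [finrank_euclideanSpace, Fintype.card_fin]
                rw [Real.rpow_neg (by positivity), Real.rpow_neg (by positivity), Real.rpow_natCast,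
                  Real.rpow_natCast, ← inv_pow, ← inv_pow, ← mul_pow]
                congr 1
                field_simp
                norm_num
            _ ≤ _ := by
                refine setLIntegral_mono' measurableSet_ball fun y hy => ?_
                refine ENNReal.ofReal_le_ofReal (Real.rpow_le_rpow_of_nonpos (by positivity) ?_
                  (by simp))
                linarith [(hmem y hy).2]
      _ = ∫⁻ y in Metric.closedBall (0 : Rd d) R ∪ U, ENNReal.ofReal ((1 + ‖y‖) ^ (-(d : ℝ))) := by
          rw [lintegral_union measurableSet_ball hdisj]; rfl
      _ ≤ _ := lintegral_mono_set hsub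

theorem exists_le_logMass {d : ℕ} {e : Rd d} (he : ‖e‖ = 1) (M R₀ : ℝ) :
    ∃ R : ℝ, R₀ ≤ R ∧ ENNReal.ofReal M ≤ logMass d R := by
  obtain ⟨c, hc, h⟩ := exists_le_logMass_sub he
  have hm : ∀ m : ℕ, (m : ℝ≥0∞) * c ≤ logMass d (2 ^ m) := by
    intro m
    induction m with
    | zero => simp
    | succ m ih =>
      have := h (2 ^ m) (one_le_pow₀ (by norm_num))
      rw [pow_succ', Nat.cast_succ, add_mul, one_mul]
      exact (add_le_add_left ih c).trans this
  obtain ⟨m₁, hm₁⟩ := ENNReal.exists_nat_mul_gt hc (b := ENNReal.ofReal M) ENNReal.ofReal_ne_top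
  obtain ⟨m₂, hm₂⟩ := pow_unbounded_of_one_lt R₀ (one_lt_two)
  refine ⟨2 ^ (max m₁ m₂), hm₂.le.trans (pow_le_pow_right₀ (by norm_num) (le_max_right _ _)), ?_⟩
  refine hm₁.le.trans ((hm m₁).trans (logMass_mono d ?_))
  exact pow_le_pow_right₀ (by norm_num) (le_max_left _ _)

theorem lintegral_tailWeight {d : ℕ} (A : ℝ) {R : ℝ} (hR : 0 < R) :
    ∫⁻ y : Rd d, ENNReal.ofReal ((1 + ‖y‖ / R) ^ (-A)) =
      ENNReal.ofReal (R ^ (d : ℝ)) * ∫⁻ y : Rd d, ENNReal.ofReal ((1 + ‖y‖) ^ (-A)) := by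
  have h := lintegral_comp_smul_Rd (d := d) (f := fun y => ENNReal.ofReal ((1 + ‖y‖) ^ (-A)))
    (by fun_prop) (inv_pos.2 hR)
  rw [Real.inv_rpow hR.le, ← Real.rpow_neg hR.le, neg_neg] at h
  rw [← h]
  congr! 5 with y
  rw [norm_smul, Real.norm_of_nonneg (by positivity), div_eq_inv_mul]

theorem eLpNorm_ofReal_eq {d : ℕ} {p : ℝ≥0∞} (hp : 0 < p) (hp' : p ≠ ∞) {w : Rd d → ℝ}
    (hw : ∀ x, 0 ≤ w x) :
    eLpNorm (fun x => ENNReal.ofReal (w x)) p volume =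
      (∫⁻ x, ENNReal.ofReal (w x ^ p.toReal)) ^ (p⁻¹).toReal := by
  rw [eLpNorm_eq_lintegral_rpow_enorm_toReal hp.ne' hp', ENNReal.toReal_inv, one_div]
  congr 2
  ext x
  rw [enorm_eq_self, ENNReal.ofReal_rpow_of_nonneg (hw x) ENNReal.toReal_nonneg]

theorem exists_eLpNorm_tailWeight_le_one {d : ℕ} {a : ℝ} (ha : 0 ≤ a) :
    ∃ A : ℝ, 0 ≤ A ∧ ∃ C : ℝ≥0, ∀ R : ℝ, 1 ≤ R →
      eLpNorm (fun x : Rd d => ENNReal.ofReal (tailWeight a A R x)) ∞ volume ≤ C := by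
  refine ⟨0, le_rfl, 1, fun R hR => ?_⟩
  rw [eLpNorm_exponent_top]
  refine eLpNormEssSup_le_of_ae_enorm_bound (Filter.Eventually.of_forall fun x => ?_)
  rw [enorm_eq_self, ENNReal.coe_one, ENNReal.ofReal_le_one]
  exact tailWeight_le_one ha le_rfl (by linarith) x

/-- The exponent `d/p` is critical, so its `p`-th power has logarithmic mass inside radius `R`. With
`A = (d + 1)/p` the outside contributes a constant by scaling, and `logMass d 1` absorbs it. -/
theorem exists_eLpNorm_tailWeight_le_logMass {d : ℕ} {p : ℝ≥0∞} (hp : 0 < p) :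
    ∃ A : ℝ, 0 ≤ A ∧ ∃ C : ℝ≥0, ∀ R : ℝ, 1 ≤ R →
      eLpNorm (fun x : Rd d => ENNReal.ofReal (tailWeight (d * (p⁻¹).toReal) A R x)) p volume ≤
        C * logMass d R ^ (p⁻¹).toReal := by
  rcases eq_or_ne p ∞ with rfl | hp'
  · simpa using exists_eLpNorm_tailWeight_le_one (d := d) le_rfl
  have hr : 0 < p.toReal := ENNReal.toReal_pos hp.ne' hp'
  set K : ℝ≥0∞ := ∫⁻ u : Rd d, ENNReal.ofReal ((1 + ‖u‖) ^ (-((d : ℝ) + 1))) with hK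
  have hKtop : K < ∞ := lintegral_one_add_norm_rpow_lt_top _ (by simp)
  have hL0 := (logMass_pos d one_pos).ne'
  have hLtop := (logMass_lt_top d 1).ne
  have hCtop : 1 + K / logMass d 1 < ∞ :=
    ENNReal.add_lt_top.2 ⟨ENNReal.one_lt_top, ENNReal.div_lt_top hKtop.ne hL0⟩
  refine ⟨(d + 1) / p.toReal, by positivity, ((1 + K / logMass d 1) ^ (p⁻¹).toReal).toNNReal,
    fun R hR => ?_⟩
  have hR0 : 0 < R := by linarith
  rw [ENNReal.coe_toNNReal (ENNReal.rpow_lt_top_of_nonneg ENNReal.toReal_nonneg hCtop.ne).ne,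
    eLpNorm_ofReal_eq hp hp' fun x => by unfold tailWeight; positivity,
    ← ENNReal.mul_rpow_of_nonneg _ _ ENNReal.toReal_nonneg]
  refine ENNReal.rpow_le_rpow ?_ ENNReal.toReal_nonneg
  have hpw : ∀ x : Rd d, tailWeight (d * (p⁻¹).toReal) ((d + 1) / p.toReal) R x ^ p.toReal =
      (1 + ‖x‖) ^ (-(d : ℝ)) * (1 + ‖x‖ / R) ^ (-((d : ℝ) + 1)) := by
    intro x
    rw [tailWeight, Real.mul_rpow (by positivity) (by positivity), ← Real.rpow_mul (by positivity),
      ← Real.rpow_mul (by positivity), ENNReal.toReal_inv]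
    congr 2 <;> field_simp
  calc ∫⁻ x : Rd d, ENNReal.ofReal
        (tailWeight (d * (p⁻¹).toReal) ((d + 1) / p.toReal) R x ^ p.toReal)
      ≤ ∫⁻ x : Rd d, ((Metric.closedBall (0 : Rd d) R).indicator
          (fun x => ENNReal.ofReal ((1 + ‖x‖) ^ (-(d : ℝ)))) x +
          ENNReal.ofReal (R ^ (-(d : ℝ))) * ENNReal.ofReal ((1 + ‖x‖ / R) ^ (-((d : ℝ) + 1)))) := by
        refine lintegral_mono fun x => ?_
        rw [hpw]
        rcases le_or_gt ‖x‖ R with hx | hx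
        · rw [Set.indicator_of_mem (by simpa using hx)]
          refine le_add_right (ENNReal.ofReal_le_ofReal (mul_le_of_le_one_right (by positivity) ?_))
          refine Real.rpow_le_one_of_one_le_of_nonpos ?_ (by linarith [Nat.cast_nonneg (α := ℝ) d])
          have : 0 ≤ ‖x‖ / R := by positivity
          linarith
        · refine le_add_left ?_
          rw [← ENNReal.ofReal_mul (by positivity)]
          refine ENNReal.ofReal_le_ofReal (mul_le_mul_of_nonneg_right ?_ (by positivity))
          exact Real.rpow_le_rpow_of_nonpos hR0 (by linarith) (by simp)
    _ = logMass d R + K := by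
        rw [lintegral_add_right _ (by fun_prop), lintegral_indicator measurableSet_closedBall,
          lintegral_const_mul _ (by fun_prop), lintegral_tailWeight _ hR0, ← mul_assoc,
          ← ENNReal.ofReal_mul (by positivity), ← Real.rpow_add hR0]
        simp [logMass, hK]
    _ ≤ (1 + K / logMass d 1) * logMass d R := by
        rw [add_mul, one_mul]
        gcongr
        calc K = K / logMass d 1 * logMass d 1 := (ENNReal.div_mul_cancel hL0 hLtop).symm
          _ ≤ _ := by gcongr; exact logMass_mono d hR

theorem exists_eLpNorm_tailWeight_le_rpow {d : ℕ} {p : ℝ≥0∞} (hp : 0 < p) :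
    ∃ A : ℝ, 0 ≤ A ∧ ∃ C : ℝ≥0, ∀ R : ℝ, 1 ≤ R →
      eLpNorm (fun x : Rd d => ENNReal.ofReal (tailWeight 0 A R x)) p volume ≤
        C * ENNReal.ofReal (R ^ (d : ℝ)) ^ (p⁻¹).toReal := by
  rcases eq_or_ne p ∞ with rfl | hp'
  · simpa using exists_eLpNorm_tailWeight_le_one (d := d) le_rfl
  have hr : 0 < p.toReal := ENNReal.toReal_pos hp.ne' hp'
  set K : ℝ≥0∞ := ∫⁻ u : Rd d, ENNReal.ofReal ((1 + ‖u‖) ^ (-((d : ℝ) + 1))) with hK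
  have hKtop : K < ∞ := lintegral_one_add_norm_rpow_lt_top _ (by simp)
  refine ⟨(d + 1) / p.toReal, by positivity, (K ^ (p⁻¹).toReal).toNNReal, fun R hR => ?_⟩
  have hR0 : 0 < R := by linarith
  rw [ENNReal.coe_toNNReal (ENNReal.rpow_lt_top_of_nonneg ENNReal.toReal_nonneg hKtop.ne).ne,
    eLpNorm_ofReal_eq hp hp' fun x => by unfold tailWeight; positivity,
    ← ENNReal.mul_rpow_of_nonneg _ _ ENNReal.toReal_nonneg]
  refine ENNReal.rpow_le_rpow (le_of_eq ?_) ENNReal.toReal_nonneg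
  rw [mul_comm, hK, ← lintegral_tailWeight _ hR0]
  congr 1
  ext x
  rw [tailWeight, neg_zero, Real.rpow_zero, one_mul, ← Real.rpow_mul (by positivity)]
  congr 2
  field_simp

/-! ### Modulated test functions and their Hardy norms -/

/-- Schwartz functions with frequencies close to `e` that are modulations of their modulus. -/
structure IsModulated {d : ℕ} (e : Rd d) (f : 𝓢(Rd d, ℂ)) : Prop where
  eq_smul_norm : ∀ x, f x = 𝐞 (inner ℝ x e) • (‖f x‖ : ℂ)
  norm_sub_le : ∀ ξ, 𝓕 (f : Rd d → ℂ) ξ ≠ 0 → ‖ξ - e‖ ≤ 1 / 4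

theorem exists_isModulated {d : ℕ} (e : Rd d) :
    ∃ b : 𝓢(Rd d, ℂ), IsModulated e b ∧ ∃ (c : ℝ≥0∞) (δ : ℝ), c ≠ 0 ∧ 0 < δ ∧ δ ≤ 1 ∧
      ∀ x, ‖x‖ ≤ δ → c ≤ ‖b x‖ₑ := by
  obtain ⟨b, B, c, δ, hc, hδ, hδ1, hbB, hB0, hcB, hsupp⟩ := exists_modulated_nonneg_schwartzMap e
  have hn : ∀ x, ‖b x‖ = B x := fun x => by
    rw [hbB, Circle.norm_smul, Complex.norm_real, Real.norm_of_nonneg (hB0 x)]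
  refine ⟨b, ⟨fun x => ?_, hsupp⟩, ENNReal.ofReal c, δ, by simpa using hc, hδ, hδ1, fun x hx => ?_⟩
  · rw [hn]; exact hbB x
  · rw [← ofReal_norm, hn]
    exact ENNReal.ofReal_le_ofReal (hcB x hx)

theorem IsModulated.fourier_eq_zero {d : ℕ} {e : Rd d} (he : ‖e‖ = 1) {b : 𝓢(Rd d, ℂ)}
    (hb : IsModulated e b) (ξ : Rd d) (hξ : ‖ξ‖ < 1 / 2) : 𝓕 (b : Rd d → ℂ) ξ = 0 := by
  by_contra hne
  have h1 := hb.norm_sub_le ξ hne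
  have h2 := norm_sub_norm_le e ξ
  rw [norm_sub_rev] at h2
  linarith

theorem hardyNorm_le_of_forall_le {d : ℕ} {Φ f : 𝓢(Rd d, ℂ)} {C : ℝ≥0} {w : Rd d → ℝ≥0∞}
    (h : ∀ t : ℝ, 0 < t → ∀ x,
      ‖∫ y : Rd d, (((t ^ d)⁻¹ : ℝ) : ℂ) * Φ (t⁻¹ • (x - y)) * f y‖ₑ ≤ C * w x) (p : ℝ≥0∞) :
    hardyNorm Φ p f ≤ C * eLpNorm w p volume := by
  refine eLpNorm_le_nnreal_smul_eLpNorm_of_ae_le_mul' (Filter.Eventually.of_forall fun x => ?_) p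
  rw [enorm_eq_self, enorm_eq_self]
  exact iSup_le fun t => iSup_le fun ht => h t ht x

theorem IsModulated.hardyNorm_lt_top {d : ℕ} {e : Rd d} (he : ‖e‖ = 1) {b : 𝓢(Rd d, ℂ)}
    (hb : IsModulated e b) (Φ : 𝓢(Rd d, ℂ)) {p : ℝ≥0∞} (hp : 0 < p) : hardyNorm Φ p b < ∞ := by
  obtain ⟨A, hA, C, hC⟩ := exists_eLpNorm_tailWeight_le_rpow (d := d) hp
  obtain ⟨D, hD, -⟩ := exists_maximal_le Φ b (hb.fourier_eq_zero he) A
  refine (hardyNorm_le_of_forall_le hD p).trans_lt (ENNReal.mul_lt_top ENNReal.coe_lt_top ?_)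
  -- At `R = 1` and `a = 0` the tail weight is just `(1 + |x|)^{-A}`.
  have h1 := hC 1 le_rfl
  simp only [tailWeight, neg_zero, Real.rpow_zero, one_mul, div_one, Real.one_rpow,
    ENNReal.ofReal_one, ENNReal.one_rpow, mul_one] at h1
  exact h1.trans_lt ENNReal.coe_lt_top

theorem integrable_modulated_truncWeight {d : ℕ} (e : Rd d) {a : ℝ} (ha : 0 ≤ a) (R : ℝ) :
    Measurable (fun y : Rd d => 𝐞 (inner ℝ y e) • (truncWeight a R y : ℂ)) ∧
    Integrable (fun y : Rd d => 𝐞 (inner ℝ y e) • (truncWeight a R y : ℂ)) := by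
  have hm : Measurable (fun y : Rd d => 𝐞 (inner ℝ y e) • (truncWeight a R y : ℂ)) := by
    have h1 : Measurable (fun y : Rd d => ((𝐞 (inner ℝ y e) : Circle) : ℂ)) :=
      (continuous_subtype_val.comp (Real.continuous_fourierChar.comp (by fun_prop))).measurable
    exact h1.mul (Complex.measurable_ofReal.comp (measurable_truncWeight a R))
  refine ⟨hm, (integrable_truncWeight ha R).mono hm.aestronglyMeasurable
    (Filter.Eventually.of_forall fun y => ?_)⟩
  rw [Circle.norm_smul, Complex.norm_real]

/-- The function is `G * b` with `G` the truncated weight modulated at `e`. Since `e^{2πi⟨y, e⟩}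
e^{2πi⟨x - y, e⟩}` does not depend on `y`, the modulus of the convolution is the convolution of the
moduli. -/
theorem exists_isModulated_truncWeight {d : ℕ} {e : Rd d} (he : ‖e‖ = 1) {b : 𝓢(Rd d, ℂ)}
    (hb : IsModulated e b) (Φ : 𝓢(Rd d, ℂ)) {a A : ℝ} (ha : 0 ≤ a) (hA : 0 ≤ A) :
    ∃ C : ℝ≥0, ∀ R : ℝ, 1 ≤ R → ∃ f : 𝓢(Rd d, ℂ), IsModulated e f ∧
      (∀ x, ‖f x‖ₑ = ∫⁻ y, ENNReal.ofReal (truncWeight a R y) * ‖b (x - y)‖ₑ) ∧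
      ∀ p, hardyNorm Φ p f ≤
        C * eLpNorm (fun x : Rd d => ENNReal.ofReal (tailWeight a A R x)) p volume := by
  obtain ⟨C₁, -, hC₁⟩ := exists_maximal_le Φ b (hb.fourier_eq_zero he) (a + A + (d + 1))
  obtain ⟨C₂, hC₂⟩ := exists_lintegral_truncWeight_le (d := d) ha hA
  refine ⟨C₁ * C₂, fun R hR => ?_⟩
  set G : Rd d → ℂ := fun y => 𝐞 (inner ℝ y e) • (truncWeight a R y : ℂ) with hG
  have hGi : Integrable G := (integrable_modulated_truncWeight e ha R).2
  have hGc : HasCompactSupport G := by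
    refine HasCompactSupport.intro (isCompact_closedBall (0 : Rd d) R) fun y hy => ?_
    rw [mem_closedBall_zero_iff, not_le] at hy
    rw [hG]
    simp [truncWeight_of_notMem hy]
  have hGn : ∀ y, ‖G y‖ₑ = ENNReal.ofReal (truncWeight a R y) := fun y => by
    rw [hG, ← ofReal_norm, Circle.norm_smul, Complex.norm_real,
      Real.norm_of_nonneg (truncWeight_nonneg _ _ _)]
  obtain ⟨f, hf, hfx⟩ := exists_schwartzMap_fourier_eq_mul hb.norm_sub_le hGi hGc
  set F : Rd d → ℝ := fun x => ∫ y, truncWeight a R y * ‖b (x - y)‖ with hF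
  have hfF : ∀ x, f x = 𝐞 (inner ℝ x e) • (F x : ℂ) := by
    intro x
    rw [hfx, hF, ← integral_complex_ofReal, Circle.smul_def, ← integral_smul]
    congr 1; ext y
    rw [hG, hb.eq_smul_norm (x - y)]
    have : inner ℝ x e = inner ℝ y e + inner ℝ (x - y) e := by
      rw [← inner_add_left, add_sub_cancel]
    rw [this, AddChar.map_add_eq_mul]
    simp only [Circle.smul_def, smul_eq_mul, Circle.coe_mul, Complex.ofReal_mul, norm_mul,
      Circle.norm_coe, Complex.norm_real, norm_norm, one_mul]
    ring
  have hF0 : ∀ x, 0 ≤ F x := fun x =>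
    integral_nonneg fun y => mul_nonneg (truncWeight_nonneg _ _ _) (norm_nonneg _)
  have hfn : ∀ x, ‖f x‖ = F x := fun x => by
    rw [hfF, Circle.norm_smul, Complex.norm_real, Real.norm_of_nonneg (hF0 x)]
  refine ⟨f, ⟨fun x => ?_, fun ξ hξ => ?_⟩, fun x => ?_, fun p => ?_⟩
  · rw [hfn]; exact hfF x
  · rw [hf] at hξ
    exact hb.norm_sub_le ξ (right_ne_zero_of_mul hξ)
  · have hbd : Integrable fun y => truncWeight a R y * ‖b (x - y)‖ := by
      refine (integrable_truncWeight ha R).mul_bdd (c := SchwartzMap.seminorm ℝ 0 0 b) ?_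
        (Filter.Eventually.of_forall fun y => ?_)
      · exact ((b.continuous.comp (continuous_const.sub continuous_id)).norm).aestronglyMeasurable
      · rw [norm_norm]; exact SchwartzMap.norm_le_seminorm ℝ _ _
    rw [← ofReal_norm, hfn, hF, ofReal_integral_eq_lintegral_ofReal hbd
      (Filter.Eventually.of_forall fun y => mul_nonneg (truncWeight_nonneg _ _ _) (norm_nonneg _))]
    congr 1; ext y
    rw [ENNReal.ofReal_mul (truncWeight_nonneg _ _ _), ofReal_norm]
  · refine hardyNorm_le_of_forall_le (fun t ht x => ?_) p
    refine (hC₁ G f hGi hf t ht x).trans ?_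
    rw [ENNReal.coe_mul, mul_assoc]
    gcongr
    simp only [hGn]
    exact hC₂ R hR x

/-! ### Size of the output and consequences of the multiplier estimate -/

/-- The product of the `fₖ` has phase `n⟨x, e⟩ - |J|⟨t, e⟩`, and the modulation of the kernel at
`|J|e` removes its dependence on `t`. What remains under the integral is nonnegative. -/
theorem enorm_multiplierOp_modulated {d n : ℕ} {e : Rd d} (J : Finset (Fin n)) {α : ℝ}
    (hα : 0 ≤ α) (R : ℝ) {X : RdPow d n → ℂ}
    (hX : ∀ ξ : RdPow d n, (∀ k, ‖ξ k - e‖ ≤ 1 / 4) → X ξ = 1) {f : Fin n → 𝓢(Rd d, ℂ)}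
    (hf : ∀ k, IsModulated e (f k)) (x : Rd d) :
    ‖multiplierOp (fun ξ => diagMultiplier J
        (fun t => 𝐞 (inner ℝ t (J.card • e)) • (truncWeight α R t : ℂ)) ξ * X ξ) f x‖ₑ =
      ∫⁻ t, ENNReal.ofReal (truncWeight α R t) * ∏ k, ‖f k (x - if k ∈ J then t else 0)‖ₑ := by
  rw [multiplierOp_diagMultiplier J (integrable_modulated_truncWeight _ hα R).2 X f]
  swap
  · intro ξ
    by_cases h0 : ∏ k, 𝓕 (f k : Rd d → ℂ) (ξ k) = 0
    · rw [h0, mul_zero]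
    · rw [hX ξ fun k => (hf k).norm_sub_le _ (Finset.prod_ne_zero_iff.1 h0 k (Finset.mem_univ k)),
        one_mul]
  have hpt : ∀ t : Rd d, (𝐞 (inner ℝ t (J.card • e)) • (truncWeight α R t : ℂ)) *
      ∏ k, f k (x - if k ∈ J then t else 0) = (𝐞 (n * inner ℝ x e) : ℂ) *
        ((truncWeight α R t * ∏ k, ‖f k (x - if k ∈ J then t else 0)‖ : ℝ) : ℂ) := by
    intro t
    have h1 : ∏ k, f k (x - if k ∈ J then t else 0) =
        (∏ k, (𝐞 (inner ℝ (x - if k ∈ J then t else 0) e) : ℂ)) *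
          ∏ k, ((‖f k (x - if k ∈ J then t else 0)‖ : ℝ) : ℂ) := by
      rw [← Finset.prod_mul_distrib]
      refine Finset.prod_congr rfl fun k _ => ?_
      conv_lhs => rw [(hf k).eq_smul_norm]
      rfl
    have h2 : ∏ k : Fin n, (𝐞 (inner ℝ (x - if k ∈ J then t else 0) e) : ℂ) =
        (𝐞 (n * inner ℝ x e - J.card * inner ℝ t e) : ℂ) := by
      simp only [Real.fourierChar_apply, ← Complex.exp_sum, ← Finset.sum_mul, ← Complex.ofReal_sum]
      congr 3
      rw [← Finset.mul_sum]
      congr 1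
      simp only [inner_sub_left, Finset.sum_sub_distrib, Finset.sum_const, Finset.card_univ,
        Fintype.card_fin, nsmul_eq_mul]
      congr 1
      have h4 : ∀ k, inner ℝ (if k ∈ J then t else 0) e = if k ∈ J then inner ℝ t e else 0 :=
        fun k => by split_ifs <;> simp
      simp only [h4, Finset.sum_ite_mem, Finset.univ_inter, Finset.sum_const, nsmul_eq_mul]
    rw [h1, h2, Circle.smul_def, smul_eq_mul]
    have h3 : (n * inner ℝ x e : ℝ) =
        inner ℝ t (J.card • e) + (n * inner ℝ x e - J.card * inner ℝ t e) := by
      rw [← Nat.cast_smul_eq_nsmul ℝ, inner_smul_right]; ring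
    conv_rhs => rw [h3]
    rw [AddChar.map_add_eq_mul]
    push_cast
    ring
  simp only [hpt]
  have hint : Integrable fun t => truncWeight α R t * ∏ k, ‖f k (x - if k ∈ J then t else 0)‖ := by
    refine (integrable_truncWeight hα R).mul_bdd (c := ∏ k, SchwartzMap.seminorm ℝ 0 0 (f k)) ?_
      (Filter.Eventually.of_forall fun y => ?_)
    · refine (continuous_finsetProd _ fun k _ => ?_).aestronglyMeasurable
      refine ((f k).continuous.comp ?_).norm
      split_ifs <;> fun_prop
    · rw [Real.norm_of_nonneg (by positivity)]
      exact Finset.prod_le_prod (fun _ _ => norm_nonneg _)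
        fun k _ => SchwartzMap.norm_le_seminorm ℝ _ _
  have hnn : ∀ t, 0 ≤ truncWeight α R t * ∏ k, ‖f k (x - if k ∈ J then t else 0)‖ := fun t =>
    mul_nonneg (truncWeight_nonneg _ _ _) (by positivity)
  rw [integral_const_mul, integral_complex_ofReal, ← ofReal_norm, norm_mul, Circle.norm_coe, one_mul,
    Complex.norm_real, Real.norm_of_nonneg (integral_nonneg hnn),
    ofReal_integral_eq_lintegral_ofReal hint (Filter.Eventually.of_forall hnn)]
  congr 1; ext t
  rw [ENNReal.ofReal_mul (truncWeight_nonneg _ _ _), ENNReal.ofReal_prod_of_nonneg (by simp)]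
  simp only [ofReal_norm]

theorem lintegral_rpow_le_eLpNorm {α : Type*} [MeasurableSpace α] {μ : Measure α} {q : ℝ≥0∞}
    (hq : 0 < q) (hq' : q < ∞) {S : Set α} (hS : MeasurableSet S) {F : α → ℂ} {G : α → ℝ≥0∞}
    (h : ∀ x ∈ S, G x ≤ ‖F x‖ₑ) :
    (∫⁻ x in S, G x ^ q.toReal ∂μ) ^ (q⁻¹).toReal ≤ eLpNorm F q μ := by
  rw [eLpNorm_eq_lintegral_rpow_enorm_toReal hq.ne' hq'.ne, ENNReal.toReal_inv, one_div]
  refine ENNReal.rpow_le_rpow ?_ (by positivity)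
  refine le_trans (setLIntegral_mono' hS fun x hx => ?_) (setLIntegral_le_lintegral S _)
  exact ENNReal.rpow_le_rpow (h x hx) ENNReal.toReal_nonneg

theorem lintegral_truncWeight_sq_le {d : ℕ} {α S : ℝ} (h : -2 * α + 2 * S ≤ -(d : ℝ)) (e : Rd d)
    (R : ℝ) :
    ∫⁻ t : Rd d, ENNReal.ofReal ((1 + ‖t‖) ^ (2 * S)) *
      ‖(𝐞 (inner ℝ t e) • (truncWeight α R t : ℂ))‖ₑ ^ 2 ≤ logMass d R := by
  rw [logMass, ← lintegral_indicator measurableSet_closedBall]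
  refine lintegral_mono fun t => ?_
  rw [← ofReal_norm, Circle.norm_smul, Complex.norm_real,
    Real.norm_of_nonneg (truncWeight_nonneg _ _ _)]
  rcases le_or_gt ‖t‖ R with ht | ht
  · rw [Set.indicator_of_mem (by simpa using ht), truncWeight_of_mem ht,
      ← ENNReal.ofReal_pow (by positivity), ← ENNReal.ofReal_mul (by positivity),
      ← Real.rpow_natCast, ← Real.rpow_mul (by positivity), ← Real.rpow_add (by positivity)]
    refine ENNReal.ofReal_le_ofReal (Real.rpow_le_rpow_of_exponent_le ?_ ?_)
    · linarith [norm_nonneg t]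
    · push_cast; linarith
  · rw [truncWeight_of_notMem ht]; simp

theorem eLpNorm_multiplierOp_le {d n : ℕ} {Φ : 𝓢(Rd d, ℂ)} {p : Fin n → ℝ≥0∞} {q : ℝ≥0∞}
    {σ : RdPow d n → ℂ} {D : ℝ≥0∞} (h : multiplierOpNorm Φ p q σ < D) {f : Fin n → 𝓢(Rd d, ℂ)}
    (hf : ∀ j, hardyNorm Φ (p j) (f j) < ∞) :
    eLpNorm (multiplierOp σ f) q volume ≤ D * ∏ j, hardyNorm Φ (p j) (f j) := by
  obtain ⟨A, hA, hAD⟩ := sInf_lt_iff.1 h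
  exact (hA f hf).trans (by gcongr)

/-- The common core of both cases: the assumed estimate, tested on the explicit multiplier, bounds
any minorant `G` of the output at the price of `logMass d R ^ (1 / 2)`. The constant depends neither
on `R` nor on the `fₖ`. -/
theorem exists_lower_bound_of_multiplier_estimate {d n : ℕ} (hn : 0 < n) {p : Fin n → ℝ≥0∞}
    {q : ℝ≥0∞} (hq : 0 < q) (hq' : q < ∞) {s : Fin n → ℝ} (hs : ∀ j, 0 < s j)
    {φ : 𝓢(RdPow d n, ℂ)} (hφ : IsDyadicPartition φ) {Φ : 𝓢(Rd d, ℂ)} {e : Rd d} (he : ‖e‖ = 1)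
    {C : ℝ≥0} (hC : ∀ σ : RdPow d n → ℂ, Measurable σ → (∃ B : ℝ, ∀ ξ, ‖σ ξ‖ ≤ B) →
      hormanderNorm φ s σ < ∞ → multiplierOpNorm Φ p q σ ≤ C * hormanderNorm φ s σ)
    {J : Finset (Fin n)} (hJ : J.Nonempty) {α : ℝ} (hα : 0 ≤ α)
    (hαs : -2 * α + 2 * ∑ j ∈ J, s j ≤ -(d : ℝ)) :
    ∃ K : ℝ≥0, ∀ R : ℝ, 1 ≤ R → ∀ f : Fin n → 𝓢(Rd d, ℂ), (∀ k, IsModulated e (f k)) →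
      (∀ k, hardyNorm Φ (p k) (f k) < ∞) → ∀ (S : Set (Rd d)) (G : Rd d → ℝ≥0∞),
      MeasurableSet S →
      (∀ x ∈ S, G x ≤ ∫⁻ t, ENNReal.ofReal (truncWeight α R t) *
        ∏ k, ‖f k (x - if k ∈ J then t else 0)‖ₑ) →
      (∫⁻ x in S, G x ^ q.toReal) ^ (q⁻¹).toReal ≤
        K * logMass d R ^ (1 / 2 : ℝ) * ∏ k, hardyNorm Φ (p k) (f k) := by
  obtain ⟨X, hXs, hXc, ⟨ρ, hρ, hXρ⟩, hX1, hXe⟩ := exists_cutoff_RdPow hn he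
  obtain ⟨C₁, hC₁⟩ := exists_hormanderNorm_diagMultiplier_le hφ hJ hs hXs hXc hρ hXρ
  -- The extra `1` gives a strict bound on the infimum defining `multiplierOpNorm`, so that an
  -- admissible constant lies below it.
  refine ⟨C * C₁ + 1, fun R hR f hf hfH S G hS hG => ?_⟩
  set h : Rd d → ℂ := fun t => 𝐞 (inner ℝ t (J.card • e)) • (truncWeight α R t : ℂ) with hh
  obtain ⟨hhm, hhi⟩ := integrable_modulated_truncWeight (J.card • e) hα R
  set σ : RdPow d n → ℂ := fun ξ => diagMultiplier J h ξ * X ξ with hσ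
  have hL0 : logMass d R ^ (1 / 2 : ℝ) ≠ 0 := by
    rw [ne_eq, ENNReal.rpow_eq_zero_iff_of_pos (by norm_num)]
    exact (logMass_pos d (by linarith)).ne'
  have hLtop : logMass d R ^ (1 / 2 : ℝ) ≠ ∞ :=
    (ENNReal.rpow_lt_top_of_nonneg (by norm_num) (logMass_lt_top d R).ne).ne
  have hσH : hormanderNorm φ s σ ≤ C₁ * logMass d R ^ (1 / 2 : ℝ) := by
    refine (hC₁ h hhm hhi).trans ?_
    gcongr
    exact lintegral_truncWeight_sq_le hαs _ R
  have hσm : Measurable σ := ((continuous_diagMultiplier J hhi).mul hXs.continuous).measurable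
  have hσb : ∃ B : ℝ, ∀ ξ, ‖σ ξ‖ ≤ B := by
    refine ⟨(∫ t, ‖h t‖) * 1, fun ξ => ?_⟩
    rw [hσ, norm_mul]
    exact mul_le_mul (norm_diagMultiplier_le J h ξ) (hX1 ξ) (norm_nonneg _)
      (integral_nonneg fun _ => norm_nonneg _)
  have hσtop : hormanderNorm φ s σ < ∞ :=
    hσH.trans_lt (ENNReal.mul_lt_top ENNReal.coe_lt_top hLtop.lt_top)
  have hop : multiplierOpNorm Φ p q σ < ((C * C₁ + 1 : ℝ≥0) : ℝ≥0∞) * logMass d R ^ (1 / 2 : ℝ) := by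
    refine (hC σ hσm hσb hσtop).trans_lt ?_
    calc (C : ℝ≥0∞) * hormanderNorm φ s σ ≤ (C * C₁ : ℝ≥0) * logMass d R ^ (1 / 2 : ℝ) := by
          rw [ENNReal.coe_mul, mul_assoc]; gcongr
      _ < _ := by
          refine ENNReal.mul_lt_mul_left hL0 hLtop ?_
          exact_mod_cast lt_add_one (C * C₁)
  refine le_trans ?_ (eLpNorm_multiplierOp_le hop hfH)
  refine lintegral_rpow_le_eLpNorm hq hq' hS fun x hx => (hG x hx).trans_eq ?_
  rw [hσ, hh, enorm_multiplierOp_modulated J hα R hXe hf]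

/-! ### The two contradictions -/

theorem not_forall_logMass_rpow_le {d : ℕ} {e : Rd d} (he : ‖e‖ = 1) {c K : ℝ≥0∞} (hc : c ≠ 0)
    (hK : K ≠ ∞) {u v : ℝ} (huv : v < u)
    (h : ∀ R : ℝ, 2 ≤ R → c * logMass d R ^ u ≤ K * logMass d R ^ v) : False := by
  have huv' : 0 < u - v := sub_pos.2 huv
  have hM : (K / c) ^ (u - v)⁻¹ ≠ ∞ :=
    (ENNReal.rpow_lt_top_of_nonneg (by positivity) (ENNReal.div_lt_top hK hc).ne).ne
  obtain ⟨R, hR, hRM⟩ := exists_le_logMass he (((K / c) ^ (u - v)⁻¹).toReal + 1) 2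
  have hL0 : logMass d R ≠ 0 := (logMass_pos d (by linarith)).ne'
  have hLtop : logMass d R ≠ ∞ := (logMass_lt_top d R).ne
  have h1 := h R hR
  have h2 : logMass d R ^ u = logMass d R ^ (u - v) * logMass d R ^ v := by
    rw [← ENNReal.rpow_add _ _ hL0 hLtop, sub_add_cancel]
  have hv0 : logMass d R ^ v ≠ 0 := by simp [ENNReal.rpow_eq_zero_iff, hL0, hLtop]
  have hvtop : logMass d R ^ v ≠ ∞ := by simp [ENNReal.rpow_eq_top_iff, hL0, hLtop]
  rw [h2, ← mul_assoc, ENNReal.mul_le_mul_iff_left hv0 hvtop] at h1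
  have h3 : logMass d R ^ (u - v) ≤ K / c := by
    rw [ENNReal.le_div_iff_mul_le (Or.inl hc) (Or.inr hK), mul_comm]; exact h1
  have h4 : logMass d R ≤ (K / c) ^ (u - v)⁻¹ := by
    rw [ENNReal.le_rpow_inv_iff huv']; exact h3
  have h5 := hRM.trans h4
  rw [ENNReal.ofReal_le_iff_le_toReal hM] at h5
  linarith

theorem ENNReal.prod_rpow_eq_rpow_sum {ι : Type*} (S : Finset ι) (a : ι → ℝ) {x : ℝ≥0∞}
    (hx : x ≠ 0) (hx' : x ≠ ∞) : ∏ k ∈ S, x ^ a k = x ^ ∑ k ∈ S, a k := by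
  classical
  induction S using Finset.induction_on with
  | empty => simp
  | insert k S hk ih => rw [Finset.prod_insert hk, Finset.sum_insert hk, ih, ENNReal.rpow_add _ _ hx hx']

theorem ENNReal.toReal_mul_toReal_inv {q : ℝ≥0∞} (hq : 0 < q) (hq' : q < ∞) :
    q.toReal * (q⁻¹).toReal = 1 := by
  rw [ENNReal.toReal_inv, mul_inv_cancel₀ (ENNReal.toReal_pos hq.ne' hq'.ne).ne']

theorem logMass_le_quarter (d : ℕ) (R : ℝ) :
    logMass d R ≤ ENNReal.ofReal (2 ^ (d : ℝ)) ^ 2 * logMass d (R / 4) := by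
  refine (logMass_le_half d R).trans ?_
  rw [sq, mul_assoc, show R / 4 = R / 2 / 2 by ring]
  gcongr
  exact logMass_le_half d (R / 2)

/-- The growth of the multiplier itself: orders of smoothness at most `d / 2` do not control the
supremum of the multiplier. -/
theorem not_multiplier_estimate_of_smoothness_le {d n : ℕ} (hn : 0 < n) {p : Fin n → ℝ≥0∞}
    {q : ℝ≥0∞} (hp : ∀ j, 0 < p j) (hq : 0 < q) (hq' : q < ∞)
    (hsum : (q⁻¹).toReal = ∑ j, ((p j)⁻¹).toReal) {s : Fin n → ℝ} (hs : ∀ j, 0 < s j)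
    {φ : 𝓢(RdPow d n, ℂ)} (hφ : IsDyadicPartition φ) {Φ : 𝓢(Rd d, ℂ)} {e : Rd d} (he : ‖e‖ = 1)
    {C : ℝ≥0} (hC : ∀ σ : RdPow d n → ℂ, Measurable σ → (∃ B : ℝ, ∀ ξ, ‖σ ξ‖ ≤ B) →
      hormanderNorm φ s σ < ∞ → multiplierOpNorm Φ p q σ ≤ C * hormanderNorm φ s σ)
    {j : Fin n} (hj : s j ≤ (d : ℝ) / 2) : False := by
  obtain ⟨b, hb, cb, δ, hcb, hδ, hδ1, hbδ⟩ := exists_isModulated e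
  obtain ⟨K, hK⟩ := exists_lower_bound_of_multiplier_estimate hn hq hq' hs hφ he hC
    (Finset.singleton_nonempty j) (α := d) (by positivity)
    (by rw [Finset.sum_singleton]; linarith)
  choose A hA C₁ hC₁ using fun k => exists_eLpNorm_tailWeight_le_rpow (d := d) (hp k)
  choose C₂ hC₂ using fun k => exists_isModulated_truncWeight he hb Φ le_rfl (hA k)
  obtain ⟨c, hc, hcl⟩ := exists_le_lintegral_truncWeight (d := d) le_rfl hδ hδ1 hcb
  set W : ℝ≥0∞ := (ENNReal.ofReal ((1 / 4) ^ d) * volume (Metric.ball (0 : Rd d) 1)) ^ (q⁻¹).toReal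
    with hW
  have hW0 : W ≠ 0 := by
    have h2 := (Metric.measure_ball_pos volume (0 : Rd d) one_pos).ne'
    have h3 : volume (Metric.ball (0 : Rd d) 1) ≠ ∞ := measure_ball_lt_top.ne
    rw [hW, ne_eq, ENNReal.rpow_eq_zero_iff]
    simp [h2, h3, ENNReal.mul_eq_top]
  refine not_forall_logMass_rpow_le he (c := c ^ n * W)
    (K := ENNReal.ofReal (2 ^ (d : ℝ)) ^ 2 * (K * ∏ k, ((C₂ k : ℝ≥0∞) * C₁ k))) (u := 1) (v := 1 / 2)
    (mul_ne_zero (pow_ne_zero _ hc) hW0) ?_ (by norm_num) fun R hR => ?_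
  · refine ENNReal.mul_ne_top (ENNReal.pow_ne_top ENNReal.ofReal_ne_top)
      (ENNReal.mul_ne_top ENNReal.coe_ne_top (ENNReal.prod_ne_top fun k _ => ?_))
    exact ENNReal.mul_ne_top ENNReal.coe_ne_top ENNReal.coe_ne_top
  have hR1 : 1 ≤ R := by linarith
  have hR0 : 0 < R := by linarith
  choose f hfm hfx hfH using fun k => hC₂ k R hR1
  set T : ℝ≥0∞ := ENNReal.ofReal (R ^ (d : ℝ)) with hT
  have hT0 : T ≠ 0 := by rw [hT, ne_eq, ENNReal.ofReal_eq_zero, not_le]; positivity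
  have hTtop : T ≠ ∞ := ENNReal.ofReal_ne_top
  have hfH' : ∀ k, hardyNorm Φ (p k) (f k) ≤ (C₂ k * C₁ k) * T ^ ((p k)⁻¹).toReal := fun k => by
    refine (hfH k (p k)).trans ?_
    rw [mul_assoc]
    gcongr
    exact hC₁ k R hR1
  have hfin : ∀ k, hardyNorm Φ (p k) (f k) < ∞ := fun k =>
    (hfH' k).trans_lt (ENNReal.mul_lt_top (ENNReal.mul_lt_top ENNReal.coe_lt_top ENNReal.coe_lt_top)
      (ENNReal.rpow_lt_top_of_nonneg ENNReal.toReal_nonneg hTtop))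
  have hlow : ∀ k (z : Rd d), ‖z‖ ≤ R / 2 → c ≤ ‖f k z‖ₑ := fun k z hz => by
    have := hcl (fun y => ‖b y‖ₑ) hbδ R hR z hz
    rw [hfx]
    simpa using this
  -- For `|x|, |t| ≤ R/4` both `x` and `x - t` stay in the ball of radius `R/2`, where every `|fₖ| ≥
  -- c`; the kernel `(1 + |t|)^{-d}` then integrates to `logMass d (R / 4)`.
  have key := hK R hR1 f hfm hfin (Metric.closedBall 0 (R / 4))
    (fun _ => c ^ n * logMass d (R / 4)) measurableSet_closedBall fun x hx => by
      rw [mem_closedBall_zero_iff] at hx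
      rw [mul_comm, logMass, ← lintegral_mul_const _ (by fun_prop)]
      refine le_trans (setLIntegral_mono' measurableSet_closedBall fun t ht => ?_)
        (setLIntegral_le_lintegral (Metric.closedBall 0 (R / 4)) _)
      rw [mem_closedBall_zero_iff] at ht
      rw [truncWeight_of_mem (by linarith)]
      gcongr
      calc c ^ n = ∏ _k : Fin n, c := by simp
        _ ≤ _ := Finset.prod_le_prod' fun k _ => hlow k _ ?_
      split_ifs
      · exact (norm_sub_le x t).trans (by linarith)
      · rw [sub_zero]; linarith
  have hvol : volume (Metric.closedBall (0 : Rd d) (R / 4)) =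
      (ENNReal.ofReal ((1 / 4) ^ d) * volume (Metric.ball (0 : Rd d) 1)) * T := by
    rw [Measure.addHaar_closedBall volume _ (by positivity), hT, mul_right_comm,
      ← ENNReal.ofReal_mul (by positivity)]
    congr 2
    simp only [finrank_euclideanSpace, Fintype.card_fin]
    rw [Real.rpow_natCast, ← mul_pow]; ring
  rw [setLIntegral_const, hvol,
    ENNReal.mul_rpow_of_nonneg ((c ^ n * logMass d (R / 4)) ^ q.toReal) _ ENNReal.toReal_nonneg,
    ← ENNReal.rpow_mul, ENNReal.toReal_mul_toReal_inv hq hq', ENNReal.rpow_one,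
    ENNReal.mul_rpow_of_nonneg _ _ ENNReal.toReal_nonneg, ← hW] at key
  have hTq0 : T ^ (q⁻¹).toReal ≠ 0 := by simp [ENNReal.rpow_eq_zero_iff, hT0, hTtop]
  have hTqtop : T ^ (q⁻¹).toReal ≠ ∞ := by simp [ENNReal.rpow_eq_top_iff, hT0, hTtop]
  have hprod : ∏ k, hardyNorm Φ (p k) (f k) ≤ (∏ k, ((C₂ k : ℝ≥0∞) * C₁ k)) * T ^ (q⁻¹).toReal := by
    refine (Finset.prod_le_prod' fun k _ => hfH' k).trans_eq ?_
    rw [Finset.prod_mul_distrib, ENNReal.prod_rpow_eq_rpow_sum _ _ hT0 hTtop, hsum]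
  have key2 : (c ^ n * logMass d (R / 4) * W) * T ^ (q⁻¹).toReal ≤
      (K * logMass d R ^ (1 / 2 : ℝ) * ∏ k, ((C₂ k : ℝ≥0∞) * C₁ k)) * T ^ (q⁻¹).toReal := by
    calc _ = c ^ n * logMass d (R / 4) * (W * T ^ (q⁻¹).toReal) := by ring
      _ ≤ _ := key
      _ ≤ K * logMass d R ^ (1 / 2 : ℝ) * ((∏ k, ((C₂ k : ℝ≥0∞) * C₁ k)) * T ^ (q⁻¹).toReal) := by
          gcongr
      _ = _ := by ring
  rw [ENNReal.mul_le_mul_iff_left hTq0 hTqtop] at key2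
  rw [ENNReal.rpow_one]
  calc c ^ n * W * logMass d R
      ≤ c ^ n * W * (ENNReal.ofReal (2 ^ (d : ℝ)) ^ 2 * logMass d (R / 4)) := by
        gcongr; exact logMass_le_quarter d R
    _ = ENNReal.ofReal (2 ^ (d : ℝ)) ^ 2 * (c ^ n * logMass d (R / 4) * W) := by ring
    _ ≤ ENNReal.ofReal (2 ^ (d : ℝ)) ^ 2 *
        (K * logMass d R ^ (1 / 2 : ℝ) * ∏ k, ((C₂ k : ℝ≥0∞) * C₁ k)) := by gcongr
    _ = _ := by ring

/-- The decay of the kernel along the diagonal of the coordinates in `J` is not controlled. -/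
theorem not_multiplier_estimate_of_sum_le {d n : ℕ} (hd : 0 < d) (hn : 0 < n) {p : Fin n → ℝ≥0∞}
    {q : ℝ≥0∞} (hp : ∀ j, 0 < p j) (hq : 0 < q) (hq' : q < ∞)
    (hsum : (q⁻¹).toReal = ∑ j, ((p j)⁻¹).toReal) {s : Fin n → ℝ} (hs : ∀ j, 0 < s j)
    {φ : 𝓢(RdPow d n, ℂ)} (hφ : IsDyadicPartition φ) {Φ : 𝓢(Rd d, ℂ)} {e : Rd d} (he : ‖e‖ = 1)
    {C : ℝ≥0} (hC : ∀ σ : RdPow d n → ℂ, Measurable σ → (∃ B : ℝ, ∀ ξ, ‖σ ξ‖ ≤ B) →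
      hormanderNorm φ s σ < ∞ → multiplierOpNorm Φ p q σ ≤ C * hormanderNorm φ s σ)
    {J : Finset (Fin n)} (hJ : J.Nonempty)
    (hJs : ∑ k ∈ J, (s k / (d : ℝ) - ((p k)⁻¹).toReal) ≤ -(1 / 2 : ℝ)) : False := by
  have hd' : (0 : ℝ) < d := by exact_mod_cast hd
  set P : ℝ := ∑ k ∈ J, ((p k)⁻¹).toReal with hP
  have hP0 : 0 ≤ P := Finset.sum_nonneg fun _ _ => ENNReal.toReal_nonneg
  have hJs' : (∑ k ∈ J, s k) / d ≤ P - 1 / 2 := by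
    rw [Finset.sum_sub_distrib, ← Finset.sum_div] at hJs
    linarith
  -- Positivity of the `sₖ` makes this strict even when the hypothesis on `J` is an equality; the
  -- final comparison of exponents rests on it.
  have hP2 : 1 / 2 < P := by
    have : 0 < (∑ k ∈ J, s k) / d := div_pos (Finset.sum_pos (fun k _ => hs k) hJ) hd'
    linarith
  rw [div_le_iff₀ hd'] at hJs'
  obtain ⟨b, hb, cb, δ, hcb, hδ, hδ1, hbδ⟩ := exists_isModulated e
  obtain ⟨K, hK⟩ := exists_lower_bound_of_multiplier_estimate hn hq hq' hs hφ he hC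
    hJ (α := d * P) (by positivity) (by linarith)
  choose A hA C₁ hC₁ using fun k => exists_eLpNorm_tailWeight_le_logMass (d := d) (hp k)
  have ha : ∀ k, 0 ≤ (d : ℝ) * ((p k)⁻¹).toReal := fun k =>
    mul_nonneg hd'.le ENNReal.toReal_nonneg
  choose C₂ hC₂ using fun k => exists_isModulated_truncWeight he hb Φ (ha k) (hA k)
  choose c hc hcl using fun k => exists_le_lintegral_truncWeight (d := d) (ha k) hδ hδ1 hcb
  obtain ⟨c₀, hc₀, hc₀l⟩ := exists_le_lintegral_truncWeight (d := d) (a := d * P) (by positivity)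
    hδ hδ1 (pow_ne_zero J.card hcb)
  set E : ℝ≥0∞ := ENNReal.ofReal (2 ^ (d : ℝ)) ^ (q⁻¹).toReal with hE
  have hEtop : E ≠ ∞ := (ENNReal.rpow_lt_top_of_nonneg ENNReal.toReal_nonneg ENNReal.ofReal_ne_top).ne
  set M : ℝ≥0∞ := (∏ k ∈ J, hardyNorm Φ (p k) b) * ∏ k ∈ Jᶜ, ((C₂ k : ℝ≥0∞) * C₁ k) with hM
  have hMtop : M ≠ ∞ := by
    refine ENNReal.mul_ne_top (ENNReal.prod_ne_top fun k _ => (hb.hardyNorm_lt_top he Φ (hp k)).ne)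
      (ENNReal.prod_ne_top fun k _ => ENNReal.mul_ne_top ENNReal.coe_ne_top ENNReal.coe_ne_top)
  have hsplit : (q⁻¹).toReal = P + ∑ k ∈ Jᶜ, ((p k)⁻¹).toReal := by
    rw [hsum, hP, Finset.sum_add_sum_compl]
  refine not_forall_logMass_rpow_le he (c := c₀ * ∏ k ∈ Jᶜ, c k) (K := E * (K * M))
    (u := (q⁻¹).toReal) (v := 1 / 2 + ∑ k ∈ Jᶜ, ((p k)⁻¹).toReal)
    (mul_ne_zero hc₀ (Finset.prod_ne_zero_iff.2 fun k _ => hc k))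
    (ENNReal.mul_ne_top hEtop (ENNReal.mul_ne_top ENNReal.coe_ne_top hMtop))
    (by linarith) fun R hR => ?_
  have hR1 : 1 ≤ R := by linarith
  have hR0 : 0 < R := by linarith
  have hL0 : logMass d R ≠ 0 := (logMass_pos d hR0).ne'
  have hLtop : logMass d R ≠ ∞ := (logMass_lt_top d R).ne
  choose g hgm hgx hgH using fun k => hC₂ k R hR1
  -- On `J` the fixed bump `b` pins `t` near `x`, so the output reproduces the kernel's decay `(1 +
  -- |x|)^{-dP}`; the other functions supply the remaining decay up to `(1 + |x|)^{-d/q}`.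
  set f : Fin n → 𝓢(Rd d, ℂ) := fun k => if k ∈ J then b else g k with hf
  have hfJ : ∀ k ∈ J, f k = b := fun k hk => if_pos hk
  have hfJ' : ∀ k ∈ Jᶜ, f k = g k := fun k hk => if_neg (Finset.mem_compl.1 hk)
  have hgH' : ∀ k, hardyNorm Φ (p k) (g k) ≤ (C₂ k * C₁ k) * logMass d R ^ ((p k)⁻¹).toReal :=
    fun k => by
      refine (hgH k (p k)).trans ?_
      rw [mul_assoc]
      gcongr
      exact hC₁ k R hR1
  have hfm : ∀ k, IsModulated e (f k) := fun k => by
    simp only [hf]; split_ifs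
    exacts [hb, hgm k]
  have hfin : ∀ k, hardyNorm Φ (p k) (f k) < ∞ := fun k => by
    simp only [hf]; split_ifs
    · exact hb.hardyNorm_lt_top he Φ (hp k)
    · exact (hgH' k).trans_lt (ENNReal.mul_lt_top
        (ENNReal.mul_lt_top ENNReal.coe_lt_top ENNReal.coe_lt_top)
        (ENNReal.rpow_lt_top_of_nonneg ENNReal.toReal_nonneg hLtop))
  have key := hK R hR1 f hfm hfin (Metric.closedBall 0 (R / 2))
    (fun x => (c₀ * ∏ k ∈ Jᶜ, c k) * ENNReal.ofReal ((1 + ‖x‖) ^ (-((d : ℝ) * (q⁻¹).toReal))))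
    measurableSet_closedBall fun x hx => by
      rw [mem_closedBall_zero_iff] at hx
      have hZ : 0 < 1 + ‖x‖ := by positivity
      have hZ0 : ENNReal.ofReal (1 + ‖x‖) ≠ 0 := by simpa using hZ
      have h1 := hc₀l (fun y => ‖b y‖ₑ ^ J.card) (fun y hy => by gcongr; exact hbδ y hy) R hR x hx
      have h2 : ∀ k ∈ Jᶜ, c k * ENNReal.ofReal ((1 + ‖x‖) ^ (-((d : ℝ) * ((p k)⁻¹).toReal))) ≤
          ‖g k x‖ₑ := fun k _ => by
        rw [hgx]; exact hcl k (fun y => ‖b y‖ₑ) hbδ R hR x hx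
      have h3 : ∀ t : Rd d, ∏ k, ‖f k (x - if k ∈ J then t else 0)‖ₑ =
          ‖b (x - t)‖ₑ ^ J.card * ∏ k ∈ Jᶜ, ‖g k x‖ₑ := fun t => by
        rw [← Finset.prod_mul_prod_compl J, ← Finset.prod_const]
        congr 1
        · exact Finset.prod_congr rfl fun k hk => by rw [hfJ k hk, if_pos hk]
        · exact Finset.prod_congr rfl fun k hk => by
            rw [hfJ' k hk, if_neg (Finset.mem_compl.1 hk), sub_zero]
      calc _ = (c₀ * ENNReal.ofReal ((1 + ‖x‖) ^ (-((d : ℝ) * P)))) *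
            ∏ k ∈ Jᶜ, (c k * ENNReal.ofReal ((1 + ‖x‖) ^ (-((d : ℝ) * ((p k)⁻¹).toReal)))) := by
            simp only [← ENNReal.ofReal_rpow_of_pos hZ]
            rw [Finset.prod_mul_distrib, ENNReal.prod_rpow_eq_rpow_sum _ _ hZ0 ENNReal.ofReal_ne_top,
              Finset.sum_neg_distrib, ← Finset.mul_sum, hsplit, mul_add, neg_add,
              ENNReal.rpow_add _ _ hZ0 ENNReal.ofReal_ne_top]
            ring
        _ ≤ (∫⁻ t, ENNReal.ofReal (truncWeight (d * P) R t) * ‖b (x - t)‖ₑ ^ J.card) *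
            ∏ k ∈ Jᶜ, ‖g k x‖ₑ := mul_le_mul' h1 (Finset.prod_le_prod' h2)
        _ ≤ ∫⁻ t, ENNReal.ofReal (truncWeight (d * P) R t) * ‖b (x - t)‖ₑ ^ J.card *
            ∏ k ∈ Jᶜ, ‖g k x‖ₑ := lintegral_mul_const_le _ _
        _ = _ := by simp only [h3, mul_assoc]
  have hint : ∫⁻ x in Metric.closedBall (0 : Rd d) (R / 2), ((c₀ * ∏ k ∈ Jᶜ, c k) *
      ENNReal.ofReal ((1 + ‖x‖) ^ (-((d : ℝ) * (q⁻¹).toReal)))) ^ q.toReal =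
      (c₀ * ∏ k ∈ Jᶜ, c k) ^ q.toReal * logMass d (R / 2) := by
    rw [logMass, ← lintegral_const_mul _ (by fun_prop)]
    congr 1; ext x
    rw [ENNReal.mul_rpow_of_nonneg _ _ ENNReal.toReal_nonneg,
      ENNReal.ofReal_rpow_of_nonneg (by positivity) ENNReal.toReal_nonneg,
      ← Real.rpow_mul (by positivity)]
    congr 3
    have := ENNReal.toReal_mul_toReal_inv hq hq'
    linear_combination (-(d : ℝ)) * this
  rw [hint, ENNReal.mul_rpow_of_nonneg _ _ ENNReal.toReal_nonneg, ← ENNReal.rpow_mul,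
    ENNReal.toReal_mul_toReal_inv hq hq', ENNReal.rpow_one] at key
  have hprod : ∏ k, hardyNorm Φ (p k) (f k) ≤
      M * logMass d R ^ ∑ k ∈ Jᶜ, ((p k)⁻¹).toReal := by
    rw [← Finset.prod_mul_prod_compl J, hM, mul_assoc]
    refine mul_le_mul' (Finset.prod_congr rfl fun k hk => by rw [hfJ k hk]).le ?_
    rw [← ENNReal.prod_rpow_eq_rpow_sum _ _ hL0 hLtop, ← Finset.prod_mul_distrib]
    exact Finset.prod_le_prod' fun k hk => by rw [hfJ' k hk]; exact hgH' k
  calc (c₀ * ∏ k ∈ Jᶜ, c k) * logMass d R ^ (q⁻¹).toReal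
      ≤ (c₀ * ∏ k ∈ Jᶜ, c k) * (E * logMass d (R / 2) ^ (q⁻¹).toReal) := by
        rw [hE, ← ENNReal.mul_rpow_of_nonneg _ _ ENNReal.toReal_nonneg]
        gcongr
        exact logMass_le_half d R
    _ = E * ((c₀ * ∏ k ∈ Jᶜ, c k) * logMass d (R / 2) ^ (q⁻¹).toReal) := by ring
    _ ≤ E * (K * logMass d R ^ (1 / 2 : ℝ) * (M * logMass d R ^ ∑ k ∈ Jᶜ, ((p k)⁻¹).toReal)) := by
        refine mul_le_mul_right (key.trans ?_) _
        gcongr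
    _ = _ := by rw [ENNReal.rpow_add _ _ hL0 hLtop]; ring

theorem theorem1p1 (d n : ℕ) (hd : 0 < d) (hn : 0 < n)
    (p : Fin n → ℝ≥0∞) (q : ℝ≥0∞) (hp : ∀ j, 0 < p j) (hq : 0 < q) (hq' : q < ∞)
    (hpq : q⁻¹ = ∑ j, (p j)⁻¹)
    (s : Fin n → ℝ) (hs : ∀ j, 0 < s j)
    (φ : 𝓢(RdPow d n, ℂ)) (hφ : IsDyadicPartition φ)
    (Φ : 𝓢(Rd d, ℂ)) (hΦ : (∫ x, Φ x) ≠ 0)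
    (h : (∃ j, s j ≤ (d : ℝ) / 2) ∨
      ∃ J : Finset (Fin n), J.Nonempty ∧
        ∑ k ∈ J, (s k / (d : ℝ) - ((p k)⁻¹).toReal) ≤ -(1 / 2 : ℝ)) :
    ¬ ∃ C : ℝ≥0, ∀ σ : RdPow d n → ℂ, Measurable σ → (∃ B : ℝ, ∀ ξ, ‖σ ξ‖ ≤ B) →
      hormanderNorm φ s σ < ∞ →
        multiplierOpNorm Φ p q σ ≤ C * hormanderNorm φ s σ := by
  rintro ⟨C, hC⟩
  have he : ‖(EuclideanSpace.single ⟨0, hd⟩ 1 : Rd d)‖ = 1 := by simp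
  have hsum : (q⁻¹).toReal = ∑ j, ((p j)⁻¹).toReal := by
    rw [hpq, ENNReal.toReal_sum fun j _ => ENNReal.inv_ne_top.2 (hp j).ne']
  rcases h with ⟨j, hj⟩ | ⟨J, hJ, hJs⟩
  · exact not_multiplier_estimate_of_smoothness_le hn hp hq hq' hsum hs hφ he hC hj
  · exact not_multiplier_estimate_of_sum_le hd hn hp hq hq' hsum hs hφ he hC hJ hJs
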